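/- Let $\Omega\subset\mathbb R^{n_0}$ be a bounded open set (e.g. a smooth bounded domain), let $r>0$, $d\ge 0$, and put $C=C([-r,0];L^2(\Omega))$ with the supremum norm $\|\cdot\|_C$ ($L^2(\Omega)$ is real). Let $A:D(A)\subset L^2(\Omega)\to L^2(\Omega)$ be a densely defined, self-adjoint, positive ($\langle Ax,x\rangle\ge 0$) linear operator with compact resolvent, and let $e^{-At}$, $t\ge 0$, be the strongly continuous semigroup generated by $-A$. Let $f:\Omega-\Omega\to\mathbb R$ be measurable with $|f|\le M_f$, and let $b:\mathbb R\to\mathbb R$ satisfy $|b(s)-b(t)|\le L_b|s-t|$ and $|b(s)|\le C_1|s|+C_2$ for all $s,t\in\mathbb R$, with $C_1,C_2\ge0$. Let $g:[-r,0]\times C\to\mathbb R$ satisfy the following. (A1) For every $\varphi\in C$ the function $g(\cdot,\varphi)$ is of bounded variation on $[-r,0]$, and its total variation is at most a constant $M_{Vg}$ independent of $\varphi$. Write $g=g_d+g_{ac}+g_s$, where, for every $\varphi\in C$, $g_d(\cdot,\varphi)$ is a step (pure jump) function, $g_{ac}(\cdot,\varphi)$ is absolutely continuous and $g_s(\cdot,\varphi)$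 is singular continuous. (A2) For every $\theta\in[-r,0]$ the maps $\varphi\mapsto g_{ac}(\theta,\varphi)$ and $\varphi\mapsto g_s(\theta,\varphi)$ are continuous on $C$. (A3) There are continuous functions $\eta_k:C\to[0,r]$ and $h_k:C\to\mathbb R$, $k\in\mathbb N$, such that for every $\varphi\in C$ the jump of $g_d(\cdot,\varphi)$ at each point $\theta\in[-r,0]$ is $g_d(\theta+0,\varphi)-g_d(\theta-0,\varphi)=\sum_{k:\,-\eta_k(\varphi)=\theta}h_k(\varphi)$ (so the jump at $-\eta_k(\varphi)$ is $h_k(\varphi)$ when these points are distinct, and there are no jumps elsewhere; at the end points, $g_d(-r-0,\varphi)=g_d(-r,\varphi)$ and $g_d(0+0,\varphi)=g_d(0,\varphi)$), and the series $\sum_k|h_k(\varphi)|$ converges, uniformly on every bounded subset of $C$. For $\varphi\in C$ let $$F(\varphi)(x)=\int_{-r}^0\Big\{\int_\Omega b(\varphi(\theta,y))\,f(x-y)\,dy\Big\}\,dg(\theta,\varphi),\qquad x\in\Omega,$$ a Lebesgue-Stieltjes integral over $[-r,0]$, and consider the initial value problem $$\frac{\partial}{\partial t}u(t)+Au(t)+d\,u(t)=F(u_t),\qquad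 u|_{[-r,0]}=\varphi,\qquad u_t(\theta)=u(t+\theta),\ \theta\in[-r,0].$$ A function $u\in C([-r,T];L^2(\Omega))$ is a mild solution on $[-r,T]$ if $u|_{[-r,0]}=\varphi$, $F(u_s)\in L^2(\Omega)$ for $0\le s\le T$, and $$u(t)=e^{-At}\varphi(0)+\int_0^te^{-A(t-s)}\{F(u_s)-d\,u(s)\}\,ds,\qquad t\in[0,T],$$ with integrable integrand. Then for every $\varphi\in C$ there is a global mild solution: a function $u:[-r,\infty)\to L^2(\Omega)$ whose restriction to $[-r,T]$ is a mild solution on $[-r,T]$ for every $T>0$. (Uniqueness is not claimed.) -/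

import Mathlib

open MeasureTheory Set Filter Topology
open scoped NNReal ENNReal

noncomputable section

namespace StieltjesDelay

/-! ### Linear part: compact resolvent and the semigroup generated by `-A` -/

section Semigroup

variable {H : Type*} [NormedAddCommGroup H] [InnerProductSpace ℝ H]

/-- `A` has compact resolvent: for some real `c`, the operator `c + A` has a two-sided bounded
inverse `R` that is compact. -/
def HasCompactResolvent (A : H →ₗ.[ℝ] H) : Prop :=
  ∃ (c : ℝ) (R : H →L[ℝ] H), IsCompactOperator R ∧
    (∀ x : H, ∃ hx : R x ∈ A.domain, c • R x + A ⟨R x, hx⟩ = x) ∧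
    (∀ x : A.domain, R (c • (x : H) + A x) = x)

/-- `S` (restricted to times `t ≥ 0`) is a strongly continuous semigroup of bounded operators
whose infinitesimal generator is `-A`, with equality of domains. -/
structure IsSemigroupGeneratedByNeg (A : H →ₗ.[ℝ] H) (S : ℝ → H →L[ℝ] H) : Prop where
  zero : S 0 = ContinuousLinearMap.id ℝ H
  add : ∀ s t : ℝ, 0 ≤ s → 0 ≤ t → S (s + t) = (S s).comp (S t)
  strongly_continuous : ∀ x : H, ContinuousOn (fun t => S t x) (Ici 0)
  generator : ∀ x y : H, (x, y) ∈ A.graph ↔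
    Tendsto (fun t : ℝ => t⁻¹ • (S t x - x)) (𝓝[>] 0) (𝓝 (-y))

open Classical in
/-- The operator `e^{-A t}`, `t ≥ 0`: the strongly continuous semigroup generated by `-A`
(and `0` if `-A` does not generate one). A generator determines its semigroup at `t ≥ 0`, so the
choice is immaterial there. -/
def expNeg (A : H →ₗ.[ℝ] H) (t : ℝ) : H →L[ℝ] H :=
  if h : ∃ S : ℝ → H →L[ℝ] H, IsSemigroupGeneratedByNeg A S then h.choose t else 0

end Semigroup

/-! ### Functions of bounded variation on `[-r, 0]` and their canonical parts -/

/-- Segments inside the subtype `[a, b]` are compact. This is needed for the Lebesgue-Stieltjes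
measure on `[a, b]` of a function of bounded variation. -/
instance instCompactIccSpaceIcc (a b : ℝ) : CompactIccSpace (Icc a b) where
  isCompact_Icc := fun {_ _} => isClosed_Icc.isCompact

/-- The jump `v(θ+0) - v(θ-0)`, where `v(-r-0) = v(-r)` and `v(0+0) = v(0)`. -/
def jump {r : ℝ} (v : Icc (-r) 0 → ℝ) (θ : Icc (-r) 0) : ℝ :=
  v.rightLim θ - v.leftLim θ

open Classical in
/-- `v` is a step function (jump function): it has bounded variation and its increments are the
sums of its jumps. -/
def IsStepFunction {r : ℝ} (v : Icc (-r) 0 → ℝ) : Prop :=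
  BoundedVariationOn v univ ∧
    ∀ a b : Icc (-r) 0, a ≤ b →
      v.rightLim b - v.leftLim a = ∑' θ : Icc (-r) 0, if θ ∈ Icc a b then jump v θ else 0

/-- `v` is absolutely continuous on `[-r, 0]`. -/
def IsAbsCont {r : ℝ} (v : Icc (-r) 0 → ℝ) : Prop :=
  AbsolutelyContinuousOnInterval (Function.extend Subtype.val v 0) (-r) 0

/-- `v` is a singular continuous function on `[-r, 0]`: continuous, of bounded variation, and with
derivative zero almost everywhere. -/
def IsSingularCont {r : ℝ} (v : Icc (-r) 0 → ℝ) : Prop :=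
  Continuous v ∧ BoundedVariationOn v univ ∧
    ∀ᵐ θ ∂(volume.restrict (Icc (-r) 0)), HasDerivAt (Function.extend Subtype.val v 0) 0 θ

/-! ### The delay term and mild solutions -/

variable {n : ℕ}

/-- The real Hilbert space `L²(Ω)`. -/
abbrev L2 (Ω : Set (EuclideanSpace ℝ (Fin n))) : Type :=
  Lp ℝ 2 (volume.restrict Ω)

/-- The phase space `C = C([-r,0]; L²(Ω))` with the supremum norm. -/
abbrev Phase (Ω : Set (EuclideanSpace ℝ (Fin n))) (r : ℝ) : Type :=
  C(Icc (-r) 0, L2 Ω)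

/-- The function
`x ↦ ∫_{[-r,0]} { ∫_Ω b(φ(θ,y)) f(x-y) dy } dg(θ,φ)`; the outer integral is taken with respect to
the signed Lebesgue-Stieltjes measure on `[-r,0]` of the function `g(·,φ)` of bounded variation. -/
def delayFun {Ω : Set (EuclideanSpace ℝ (Fin n))} {r : ℝ} (b : ℝ → ℝ)
    (f : EuclideanSpace ℝ (Fin n) → ℝ) (g : Icc (-r) 0 → Phase Ω r → ℝ)
    (hg : ∀ φ, BoundedVariationOn (fun θ => g θ φ) univ) (φ : Phase Ω r)
    (x : EuclideanSpace ℝ (Fin n)) : ℝ :=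
  ∫ᵛ θ, (∫ y in Ω, b (φ θ y) * f (x - y)) ∂•(hg φ).vectorMeasure

open Classical in
/-- The nonlinear map `F : C → L²(Ω)` (with value `0` where `delayFun` is not square integrable). -/
def delayMap {Ω : Set (EuclideanSpace ℝ (Fin n))} {r : ℝ} (b : ℝ → ℝ)
    (f : EuclideanSpace ℝ (Fin n) → ℝ) (g : Icc (-r) 0 → Phase Ω r → ℝ)
    (hg : ∀ φ, BoundedVariationOn (fun θ => g θ φ) univ) (φ : Phase Ω r) : L2 Ω :=
  if h : MemLp (delayFun b f g hg φ) 2 (volume.restrict Ω) then h.toLp else 0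

/-- The history segment `u_t(θ) = u(t+θ)`, `θ ∈ [-r,0]` (and `0` if it is not continuous). -/
def history {Ω : Set (EuclideanSpace ℝ (Fin n))} (r : ℝ) (u : ℝ → L2 Ω) (t : ℝ) : Phase Ω r :=
  ContinuousMap.mkD (fun θ : Icc (-r) 0 => u (t + θ)) 0

/-- `u` is a mild solution on `[-r,T]` of `u' + A u + d u = F(u_t)`, `u|_{[-r,0]} = φ`. Only the
values of `u` on `[-r,T]` matter. -/
structure IsMildSolution {Ω : Set (EuclideanSpace ℝ (Fin n))} {r : ℝ} (A : L2 Ω →ₗ.[ℝ] L2 Ω)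
    (d : ℝ) (b : ℝ → ℝ) (f : EuclideanSpace ℝ (Fin n) → ℝ) (g : Icc (-r) 0 → Phase Ω r → ℝ)
    (hg : ∀ φ, BoundedVariationOn (fun θ => g θ φ) univ) (φ : Phase Ω r) (T : ℝ)
    (u : ℝ → L2 Ω) : Prop where
  continuousOn : ContinuousOn u (Icc (-r) T)
  initial : ∀ θ : Icc (-r) 0, u θ = φ θ
  /-- `F(u_s)` is well defined as an element of `L²(Ω)`. -/
  memLp : ∀ s ∈ Icc 0 T, MemLp (delayFun b f g hg (history r u s)) 2 (volume.restrict Ω)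
  integrable : ∀ t ∈ Icc 0 T, IntervalIntegrable
    (fun s => expNeg A (t - s) (delayMap b f g hg (history r u s) - d • u s)) volume 0 t
  eq : ∀ t ∈ Icc 0 T, u t = expNeg A t (u 0) +
    ∫ s in (0 : ℝ)..t, expNeg A (t - s) (delayMap b f g hg (history r u s) - d • u s)

end StieltjesDelay

end

/-! The problem reads u' + Au = G(u_t) with G(ψ) = F(ψ) - d ψ(0). No Lipschitz condition on F is
available, so existence rests on compactness: it suffices that G is continuous with linear growth
and that e^{-At} is a contraction semigroup, compact for t > 0.

Semigroup (`expNeg_spec`). The compact resolvent R is symmetric, so an eigenbasis diagonalises A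
with eigenvalues l i ≥ 0. Then e^{-At} has multipliers e^{-l i t}, and for t > 0 it factors through
R.

Abstract existence (`exists_global_solution`). Delaying the history by ε = 1/(n+1) makes the
integral equation solvable by finitely many Picard iterations on (-∞, n]. An exponential weight
bounds all iterates uniformly in ε. The Duhamel operator sends the resulting bounded forcings into a
relatively compact subset of C(ℝ, H), by Arzelà-Ascoli, and a subsequential limit solves the
undelayed equation.

Continuity of F (`delayMap_spec`). For fixed x the inner integral is Lipschitz in the L² argument.
It is therefore enough that ∫ p dg(·,φ) depends continuously on φ for each fixed continuous p
(`continuous_integral_vectorMeasure`). The uniform bound on the variation makes this joint in p and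
φ, and dominated convergence gives continuity into L². For fixed p, the jumps contribute ∑ h k φ ·
p(-η k φ), a locally uniformly convergent series of continuous terms; the continuous parts are
approximated by increments over a fine partition, which are continuous in φ by (A2). -/

noncomputable section

namespace StieltjesDelay

universe u

/-! ### Eigenbases and diagonal operators -/

section Spectral

variable {H : Type u} [NormedAddCommGroup H] [InnerProductSpace ℝ H]

/-- A compact symmetric operator on a Hilbert space has a Hilbert basis of eigenvectors. -/
theorem exists_hilbertBasis_eigenvectors [CompleteSpace H] {R : H →L[ℝ] H}
    (hR : IsCompactOperator R) (hsymm : (R : H →ₗ[ℝ] H).IsSymmetric) :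
    ∃ (ι : Type u) (b : HilbertBasis ι ℝ H) (μ : ι → ℝ), ∀ i, R (b i) = μ i • b i := by
  obtain ⟨V, hV⟩ : ∃ V : ℝ → Submodule ℝ H,
      V = fun μ => Module.End.eigenspace (R : H →ₗ[ℝ] H) μ := ⟨_, rfl⟩
  have hmem : ∀ μ x, x ∈ V μ ↔ R x = μ • x := by
    intro μ x
    rw [hV]
    exact Module.End.mem_eigenspace_iff
  have horth : OrthogonalFamily ℝ (fun μ => V μ) fun μ => (V μ).subtypeₗᵢ := by
    rw [hV]
    exact hsymm.orthogonalFamily_eigenspaces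
  have hbot : (⨆ μ, V μ)ᗮ = ⊥ := by
    rw [hV]
    exact ContinuousLinearMap.orthogonalComplement_iSup_eigenspaces_eq_bot hR hsymm
  have hclosed : ∀ μ : ℝ, IsClosed (V μ : Set H) := by
    intro μ
    have : (V μ : Set H) = {x | R x = μ • x} := by
      ext x
      exact hmem μ x
    rw [this]
    exact isClosed_eq R.continuous (continuous_const_smul μ)
  have : ∀ μ : ℝ, CompleteSpace (V μ) := fun μ => (hclosed μ).completeSpace_coe
  choose w β _ using fun μ : ℝ => exists_hilbertBasis ℝ (V μ)
  have hon : Orthonormal ℝ fun a : Σ μ : ℝ, w μ => (β a.1 a.2 : H) :=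
    horth.orthonormal_sigma_orthonormal (v_family := fun μ => β μ) (fun μ => (β μ).orthonormal)
  -- A vector orthogonal to all chosen basis vectors is orthogonal to each whole eigenspace, by
  -- Fourier expansion there; the eigenspaces together are total.
  have hspan : (Submodule.span ℝ (range fun a : Σ μ : ℝ, w μ => (β a.1 a.2 : H)))ᗮ = ⊥ := by
    rw [eq_bot_iff, ← hbot]
    intro x hx
    rw [Submodule.mem_orthogonal'] at hx ⊢
    suffices h : (⨆ μ, V μ) ≤ LinearMap.ker (innerSL ℝ x : H →ₗ[ℝ] ℝ) by
      intro u hu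
      simpa using h hu
    refine iSup_le fun μ y hy => ?_
    have hs := ((β μ).hasSum_repr ⟨y, hy⟩).mapL (innerSL ℝ x ∘L (V μ).subtypeL)
    have h0 : ∀ i, (innerSL ℝ x ∘L (V μ).subtypeL)
        ((β μ).repr ⟨y, hy⟩ i • β μ i) = 0 := by
      intro i
      rw [map_smul, show (innerSL ℝ x ∘L (V μ).subtypeL) (β μ i) = 0 from
        hx _ (Submodule.subset_span ⟨⟨μ, i⟩, rfl⟩), smul_zero]
    simp only [h0] at hs
    exact hs.unique hasSum_zero
  refine ⟨_, HilbertBasis.mkOfOrthogonalEqBot hon hspan, fun a => a.1, fun a => ?_⟩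
  rw [HilbertBasis.coe_mkOfOrthogonalEqBot]
  exact (hmem _ _).1 (β a.1 a.2).2

variable {ι : Type*}

theorem _root_.HilbertBasis.summable_sq (b : HilbertBasis ι ℝ H) (x : H) :
    Summable fun i => (b.repr x i) ^ 2 := by
  have := (lp.memℓp (b.repr x)).summable (by norm_num)
  simpa using this

theorem _root_.HilbertBasis.norm_sq_eq_tsum (b : HilbertBasis ι ℝ H) (x : H) :
    ‖x‖ ^ 2 = ∑' i, (b.repr x i) ^ 2 := by
  have := lp.norm_rpow_eq_tsum (by norm_num : 0 < (2 : ℝ≥0∞).toReal) (b.repr x)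
  simpa using this

/-- Bounded diagonal operators. -/
theorem _root_.HilbertBasis.exists_diagonal (b : HilbertBasis ι ℝ H) (m : ι → ℝ) {C : ℝ}
    (hm : ∀ i, |m i| ≤ C) (hC : 0 ≤ C) :
    ∃ D : H →L[ℝ] H, ‖D‖ ≤ C ∧ ∀ x i, b.repr (D x) i = m i * b.repr x i := by
  have hle : ∀ x i, (m i * b.repr x i) ^ 2 ≤ C ^ 2 * (b.repr x i) ^ 2 := by
    intro x i
    rw [mul_pow]
    exact mul_le_mul_of_nonneg_right
      (sq_le_sq' (abs_le.1 (hm i)).1 (abs_le.1 (hm i)).2) (sq_nonneg _)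
  have hmem : ∀ x, Memℓp (fun i => m i * b.repr x i) 2 := by
    intro x
    refine memℓp_gen ?_
    have : Summable fun i => (m i * b.repr x i) ^ 2 :=
      Summable.of_nonneg_of_le (fun _ => sq_nonneg _) (hle x) ((b.summable_sq x).mul_left _)
    simpa [← abs_mul] using this
  let D₀ : H →ₗ[ℝ] H :=
    { toFun := fun x => b.repr.symm ⟨fun i => m i * b.repr x i, hmem x⟩
      map_add' := fun x y => by
        rw [← map_add]
        congr 1
        ext i
        exact (congrArg (m i * ·) (by rw [map_add]; rfl)).trans (mul_add _ _ _)
      map_smul' := fun c x => by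
        rw [RingHom.id_apply, ← map_smul]
        congr 1
        ext i
        exact (congrArg (m i * ·) (by rw [map_smul]; rfl)).trans (mul_left_comm _ c _) }
  have hD₀ : ∀ x i, b.repr (D₀ x) i = m i * b.repr x i := by
    intro x i
    simp [D₀]
  have hb : ∀ x, ‖D₀ x‖ ≤ C * ‖x‖ := by
    intro x
    refine le_of_sq_le_sq ?_ (by positivity)
    rw [mul_pow, b.norm_sq_eq_tsum, b.norm_sq_eq_tsum x, ← tsum_mul_left]
    simp only [hD₀]
    exact Summable.tsum_le_tsum (hle x)
      (Summable.of_nonneg_of_le (fun _ => sq_nonneg _) (hle x) ((b.summable_sq x).mul_left _))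
      ((b.summable_sq x).mul_left _)
  exact ⟨D₀.mkContinuous C hb, D₀.mkContinuous_norm_le hC hb, hD₀⟩

theorem _root_.HilbertBasis.ext_repr (b : HilbertBasis ι ℝ H) {x y : H}
    (h : ∀ i, b.repr x i = b.repr y i) : x = y :=
  b.repr.injective (by ext i; exact h i)

/-- Parseval turns this into dominated convergence for the series of squared coordinate errors. It
yields both strong continuity of the semigroup and the limit defining its generator. -/
theorem _root_.HilbertBasis.tendsto_of_dominated (b : HilbertBasis ι ℝ H) {α : Type*} {l : Filter α}
    {u : α → H} {y : H} {β : ι → ℝ} (hβ : Summable fun i => β i ^ 2)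
    (hb : ∀ᶠ a in l, ∀ i, |b.repr (u a) i - b.repr y i| ≤ β i)
    (hlim : ∀ i, Tendsto (fun a => b.repr (u a) i) l (𝓝 (b.repr y i))) : Tendsto u l (𝓝 y) := by
  rw [tendsto_iff_norm_sub_tendsto_zero]
  have h := tendsto_tsum_of_dominated_convergence (𝓕 := l)
    (f := fun a i => (b.repr (u a) i - b.repr y i) ^ 2) (g := fun _ => (0 : ℝ)) hβ
    (fun i => by
      have := ((hlim i).sub_const (b.repr y i)).pow 2
      simpa using this)
    (by
      filter_upwards [hb] with a ha i
      rw [Real.norm_of_nonneg (sq_nonneg _)]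
      exact sq_le_sq' (abs_le.1 (ha i)).1 (abs_le.1 (ha i)).2)
  have h2 : Tendsto (fun a => √(‖u a - y‖ ^ 2)) l (𝓝 (√0)) := by
    refine (Real.continuous_sqrt.tendsto 0).comp ?_
    rw [tsum_zero] at h
    refine h.congr fun a => ?_
    rw [b.norm_sq_eq_tsum]
    simp
  simpa using h2

end Spectral

/-! ### The semigroup generated by `-A`: existence, contractivity, compactness -/

section Generation

variable {H : Type u} [NormedAddCommGroup H] [InnerProductSpace ℝ H]

/-- Spectral decomposition of a self-adjoint, positive operator with compact resolvent. -/
theorem exists_spectral_decomposition [CompleteSpace H] {A : H →ₗ.[ℝ] H} (hdense : Dense (A.domain : Set H))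
    (hsa : IsSelfAdjoint A) (hpos : ∀ x : A.domain, 0 ≤ inner ℝ (A x) (x : H))
    (hres : HasCompactResolvent A) :
    ∃ (ι : Type u) (b : HilbertBasis ι ℝ H) (l : ι → ℝ) (c : ℝ) (R : H →L[ℝ] H),
      IsCompactOperator R ∧ (∀ i, 0 ≤ l i) ∧ (∀ i, c + l i ≠ 0) ∧
      (∀ x i, b.repr (R x) i = (c + l i)⁻¹ * b.repr x i) ∧
      (∀ i, (b i, l i • b i) ∈ A.graph) ∧
      ∀ x y, (x, y) ∈ A.graph ↔ ∀ i, b.repr y i = l i * b.repr x i := by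
  obtain ⟨c, R, hRc, hR1, hR2⟩ := hres
  have hformal := LinearPMap.adjoint_isFormalAdjoint hdense
  rw [LinearPMap.isSelfAdjoint_def.1 hsa] at hformal
  -- Write each free vector as (c + A)R of itself and use the symmetry of A.
  have hRsymm : ∀ x y, inner ℝ (R x) y = inner ℝ x (R y) := by
    intro x y
    obtain ⟨hx, ex⟩ := hR1 x
    obtain ⟨hy, ey⟩ := hR1 y
    have := hformal ⟨R x, hx⟩ ⟨R y, hy⟩
    conv_lhs => rw [← ey]
    conv_rhs => rw [← ex]
    rw [inner_add_right, inner_add_left, inner_smul_left, inner_smul_right]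
    simp only [conj_trivial]
    rw [← this]
  obtain ⟨ι, b, μ, hμ⟩ := exists_hilbertBasis_eigenvectors hRc
    (fun x y => hRsymm x y)
  have hbne : ∀ i, b i ≠ 0 := fun i => b.orthonormal.ne_zero i
  have hμ0 : ∀ i, μ i ≠ 0 := by
    intro i h0
    obtain ⟨hx, ex⟩ := hR1 (b i)
    have hz : (⟨R (b i), hx⟩ : A.domain) = 0 := by
      ext; simp [hμ i, h0]
    rw [hz, LinearPMap.map_zero, hμ i, h0] at ex
    exact hbne i (by simpa using ex.symm)
  have hgr : ∀ i, (b i, ((μ i)⁻¹ - c) • b i) ∈ A.graph := by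
    intro i
    obtain ⟨hx, ex⟩ := hR1 (b i)
    have hg : (R (b i), A ⟨R (b i), hx⟩) ∈ A.graph := A.mem_graph ⟨R (b i), hx⟩
    have h1 : A ⟨R (b i), hx⟩ = b i - c • R (b i) := by
      rw [eq_sub_iff_add_eq, add_comm]; exact ex
    rw [h1, hμ i] at hg
    have h2 := A.graph.smul_mem (μ i)⁻¹ hg
    simp only [Prod.smul_mk, smul_smul, smul_sub, inv_mul_cancel₀ (hμ0 i), one_smul] at h2
    rw [sub_smul]
    convert h2 using 4
    field_simp [hμ0 i]
  have hRrepr : ∀ x i, b.repr (R x) i = μ i * b.repr x i := by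
    intro x i
    rw [b.repr_apply_apply, b.repr_apply_apply, ← hRsymm, hμ i, inner_smul_left]
    simp
  refine ⟨ι, b, fun i => (μ i)⁻¹ - c, c, R, hRc, ?_, ?_, ?_, hgr, ?_⟩
  · intro i
    obtain ⟨y, hy1, hy2⟩ := (LinearPMap.mem_graph_iff A).1 (hgr i)
    have := hpos y
    simp only at hy1 hy2
    rw [hy2, hy1, inner_smul_left, real_inner_self_eq_norm_sq, b.orthonormal.1 i] at this
    simpa using this
  · intro i
    simpa using hμ0 i
  · intro x i
    rw [hRrepr]; simp
  · intro x y
    constructor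
    · intro h i
      obtain ⟨x', hx1, hx2⟩ := (LinearPMap.mem_graph_iff A).1 h
      obtain ⟨e, he1, he2⟩ := (LinearPMap.mem_graph_iff A).1 (hgr i)
      have := hformal e x'
      simp only at hx1 hx2 he1 he2
      rw [hx1, hx2, he1, he2, inner_smul_left] at this
      rw [b.repr_apply_apply, b.repr_apply_apply, ← this]
      simp
    · intro h
      -- This puts x in the range of R, hence in the domain: the converse needs maximality of A,
      -- which the resolvent supplies.
      have hx : x = R (c • x + y) := by
        refine b.ext_repr fun i => ?_
        rw [hRrepr, map_add, map_smul]
        simp only [lp.coeFn_add, lp.coeFn_smul, Pi.add_apply, Pi.smul_apply, smul_eq_mul, h i]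
        field_simp [hμ0 i]
        ring
      obtain ⟨hd, e⟩ := hR1 (c • x + y)
      refine (LinearPMap.mem_graph_iff A).2 ⟨⟨_, hd⟩, hx.symm, ?_⟩
      have e' : c • x + A ⟨R (c • x + y), hd⟩ = c • x + y := by
        conv_lhs => enter [1]; rw [hx]
        exact e
      exact add_left_cancel e'

theorem exp_neg_mul_le_one {l t : ℝ} (hl : 0 ≤ l) (ht : 0 ≤ t) : Real.exp (-(l * t)) ≤ 1 := by
  rw [Real.exp_le_one_iff]; nlinarith

/-- A semigroup acts on the eigenvectors of its generator by exponentials. -/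
theorem IsSemigroupGeneratedByNeg.apply_eigenvector {A : H →ₗ.[ℝ] H} {S : ℝ → H →L[ℝ] H}
    (hS : IsSemigroupGeneratedByNeg A S) {e : H} {l : ℝ} (he : (e, l • e) ∈ A.graph) {t : ℝ}
    (ht : 0 ≤ t) : S t e = Real.exp (-(l * t)) • e := by
  have hgen := (hS.generator _ _).1 he
  have hcont := hS.strongly_continuous e
  have hder : ∀ x : ℝ, 0 ≤ x → HasDerivWithinAt (fun t => S t e) (-(l • S x e)) (Ici x) x := by
    intro x hx
    rw [← hasDerivWithinAt_Ioi_iff_Ici, hasDerivWithinAt_iff_tendsto_slope' (by simp)]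
    have h1 : Tendsto (fun t : ℝ => S x (t⁻¹ • (S t e - e))) (𝓝[>] 0) (𝓝 (S x (-(l • e)))) :=
      ((S x).continuous.tendsto _).comp hgen
    have h2 : Tendsto (fun y : ℝ => y - x) (𝓝[>] x) (𝓝[>] 0) := by
      refine tendsto_nhdsWithin_iff.2 ⟨?_, ?_⟩
      · have : Tendsto (fun y : ℝ => y - x) (𝓝 x) (𝓝 (x - x)) :=
          (continuous_id.sub continuous_const).tendsto x
        rw [sub_self] at this
        exact this.mono_left nhdsWithin_le_nhds
      · filter_upwards [self_mem_nhdsWithin] with y hy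
        exact sub_pos.2 (mem_Ioi.1 hy)
    have h3 := h1.comp h2
    rw [map_neg, map_smul] at h3
    refine h3.congr' ?_
    filter_upwards [self_mem_nhdsWithin] with y hy
    have hy' : 0 ≤ y - x := (sub_pos.2 (mem_Ioi.1 hy)).le
    have hadd := congrArg (fun T : H →L[ℝ] H => T e) (hS.add x (y - x) hx hy')
    simp only [add_sub_cancel, ContinuousLinearMap.comp_apply] at hadd
    simp [slope_def_module, hadd, map_smul, map_sub]
  -- The generator only provides right derivatives; a continuous function with vanishing right
  -- derivative is still constant.
  have hc := constant_of_has_deriv_right_zero (f := fun s => Real.exp (l * s) • S s e)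
    (a := 0) (b := t) (ContinuousOn.smul (by fun_prop) (hcont.mono fun _ h => h.1)) ?_ t
    ⟨ht, le_rfl⟩
  · simp only [mul_zero, Real.exp_zero, one_smul, hS.zero, ContinuousLinearMap.id_apply] at hc
    conv_rhs => rw [← hc]
    rw [smul_smul, ← Real.exp_add]
    simp
  · intro x hx
    have hexp : HasDerivWithinAt (fun s : ℝ => Real.exp (l * s)) (Real.exp (l * x) * l)
        (Ici x) x := by
      have := ((hasDerivAt_id x).const_mul l).exp
      simpa using this.hasDerivWithinAt
    have h0 : Real.exp (l * x) • -(l • S x e) + (Real.exp (l * x) * l) • S x e = 0 := by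
      rw [smul_neg, smul_smul, neg_add_cancel]
    rw [← h0]
    exact hexp.smul (hder x hx.1)

/-- The multipliers e^{-l i t} do it. The domain comes out exactly right because convergence of the
difference quotients forces the coordinate relation of the graph, and that relation in turn provides
a square-summable majorant. -/
theorem exists_isSemigroupGeneratedByNeg {A : H →ₗ.[ℝ] H} {ι : Type*} (b : HilbertBasis ι ℝ H)
    {l : ι → ℝ} (hl : ∀ i, 0 ≤ l i)
    (hgraph : ∀ x y, (x, y) ∈ A.graph ↔ ∀ i, b.repr y i = l i * b.repr x i) :
    ∃ S : ℝ → H →L[ℝ] H, IsSemigroupGeneratedByNeg A S := by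
  have hex : ∀ t : ℝ, ∃ D : H →L[ℝ] H, ‖D‖ ≤ 1 ∧
      ∀ x i, b.repr (D x) i = Real.exp (-(l i * max t 0)) * b.repr x i := fun t =>
    b.exists_diagonal _ (fun i => by
      rw [abs_of_pos (Real.exp_pos _)]
      exact exp_neg_mul_le_one (hl i) (le_max_right _ _)) zero_le_one
  choose S hSn hS using hex
  have hS' : ∀ t : ℝ, 0 ≤ t → ∀ x i, b.repr (S t x) i = Real.exp (-(l i * t)) * b.repr x i := by
    intro t ht x i
    rw [hS, max_eq_left ht]
  refine ⟨S, ?_, ?_, ?_, ?_⟩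
  · ext x
    refine b.ext_repr fun i => ?_
    rw [hS' 0 le_rfl]; simp
  · intro s t hs ht
    ext x
    refine b.ext_repr fun i => ?_
    rw [ContinuousLinearMap.comp_apply, hS' _ (add_nonneg hs ht), hS' s hs, hS' t ht, ← mul_assoc,
      ← Real.exp_add]
    ring_nf
  · intro x
    suffices h : Continuous fun t => S t x from h.continuousOn
    refine continuous_iff_continuousAt.2 fun t => ?_
    refine b.tendsto_of_dominated (β := fun i => |b.repr x i|) ?_ ?_ ?_
    · simpa using b.summable_sq x
    · refine Eventually.of_forall fun s i => ?_
      rw [hS, hS, ← sub_mul, abs_mul]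
      refine mul_le_of_le_one_left (abs_nonneg _) ?_
      have h1 := exp_neg_mul_le_one (hl i) (le_max_right s 0)
      have h2 := exp_neg_mul_le_one (hl i) (le_max_right t 0)
      have h3 := Real.exp_pos (-(l i * max s 0))
      have h4 := Real.exp_pos (-(l i * max t 0))
      rw [abs_le]; constructor <;> linarith
    · intro i
      simp only [hS]
      exact Continuous.tendsto (by fun_prop) t
  · intro x y
    rw [hgraph]
    have hrep : ∀ t : ℝ, 0 < t → ∀ i, b.repr (t⁻¹ • (S t x - x)) i =
        t⁻¹ * (Real.exp (-(l i * t)) - 1) * b.repr x i := by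
      intro t ht i
      rw [map_smul, map_sub]
      simp only [lp.coeFn_smul, lp.coeFn_sub, Pi.smul_apply, Pi.sub_apply, smul_eq_mul,
        hS' t ht.le]
      ring
    have hlim : ∀ i, Tendsto (fun t : ℝ => b.repr (t⁻¹ • (S t x - x)) i) (𝓝[>] 0)
        (𝓝 (-(l i * b.repr x i))) := by
      intro i
      have hd : HasDerivAt (fun t : ℝ => Real.exp (-(l i * t))) (-(l i)) 0 := by
        have := (((hasDerivAt_id (0 : ℝ)).const_mul (l i)).neg).exp
        simpa using this
      have h1 := (hd.tendsto_slope_zero_right).mul_const (b.repr x i)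
      rw [← neg_mul]
      refine h1.congr' ?_
      filter_upwards [self_mem_nhdsWithin] with t ht
      rw [hrep t ht]
      simp
    constructor
    · intro h
      -- The quotient (e^{-lt} - 1)/t lies in [-l, 0], so its distance to -l is at most 2l, and l i
      -- |x i| = |y i|.
      refine b.tendsto_of_dominated (β := fun i => 2 * |b.repr y i|) ?_ ?_ ?_
      · simpa [mul_pow] using (b.summable_sq y).mul_left (2 ^ 2)
      · filter_upwards [self_mem_nhdsWithin] with t ht i
        have ht' : 0 < t := ht
        rw [hrep t ht]
        simp only [map_neg, lp.coeFn_neg, Pi.neg_apply, h i]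
        rw [show t⁻¹ * (Real.exp (-(l i * t)) - 1) * b.repr x i - -(l i * b.repr x i) =
          (t⁻¹ * (Real.exp (-(l i * t)) - 1) + l i) * b.repr x i by ring, abs_mul, abs_mul,
          ← mul_assoc]
        refine mul_le_mul_of_nonneg_right ?_ (abs_nonneg _)
        have e1 : -(l i * t) + 1 ≤ Real.exp (-(l i * t)) := Real.add_one_le_exp _
        have e2 := exp_neg_mul_le_one (hl i) ht'.le
        have e3 : t⁻¹ * (Real.exp (-(l i * t)) - 1) ≤ 0 :=
          mul_nonpos_of_nonneg_of_nonpos (by positivity) (by linarith)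
        have e4 : -(l i) ≤ t⁻¹ * (Real.exp (-(l i * t)) - 1) := by
          rw [← div_eq_inv_mul, le_div_iff₀ ht']; linarith
        rw [abs_of_nonneg (hl i), abs_le]
        constructor <;> linarith [hl i]
      · intro i
        have := hlim i
        rw [map_neg, lp.coeFn_neg, Pi.neg_apply, h i]
        exact this
    · intro h i
      have hcoord : Continuous fun z : H => b.repr z i := by
        simp only [b.repr_apply_apply]
        fun_prop
      have := tendsto_nhds_unique ((hcoord.tendsto _).comp h) (hlim i)
      simp only [map_neg, lp.coeFn_neg, Pi.neg_apply] at this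
      exact neg_injective this

/-- The semigroup generated by `-A` consists of contractions that are compact at positive times. -/
theorem expNeg_spec [CompleteSpace H] {A : H →ₗ.[ℝ] H} (hdense : Dense (A.domain : Set H))
    (hsa : IsSelfAdjoint A) (hpos : ∀ x : A.domain, 0 ≤ inner ℝ (A x) (x : H))
    (hres : HasCompactResolvent A) :
    IsSemigroupGeneratedByNeg A (expNeg A) ∧ (∀ t, 0 ≤ t → ‖expNeg A t‖ ≤ 1) ∧
      ∀ t, 0 < t → IsCompactOperator (expNeg A t) := by
  obtain ⟨ι, b, l, c, R, hRc, hl, hcl, hR, hgr, hgraph⟩ :=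
    exists_spectral_decomposition hdense hsa hpos hres
  have hex := exists_isSemigroupGeneratedByNeg b hl hgraph
  have hS : IsSemigroupGeneratedByNeg A (expNeg A) := by
    have : expNeg A = hex.choose := by
      funext t
      simp only [expNeg, dif_pos hex]
    rw [this]
    exact hex.choose_spec
  -- `expNeg` is a chosen semigroup, but its values on eigenvectors are forced, and these span a
  -- dense subspace.
  have hdiag : ∀ (D : H →L[ℝ] H) (t : ℝ), 0 ≤ t →
      (∀ x i, b.repr (D x) i = Real.exp (-(l i * t)) * b.repr x i) → expNeg A t = D := by
    intro D t ht hD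
    refine ContinuousLinearMap.ext_on (s := range b)
      (Submodule.dense_iff_topologicalClosure_eq_top.2 b.dense_span) ?_
    rintro _ ⟨i, rfl⟩
    rw [hS.apply_eigenvector (hgr i) ht]
    refine b.ext_repr fun j => ?_
    classical
    rw [hD, map_smul, b.repr_self]
    simp only [lp.coeFn_smul, Pi.smul_apply, smul_eq_mul]
    rcases eq_or_ne j i with rfl | hj
    · rfl
    · simp [lp.single_apply, hj]
  refine ⟨hS, fun t ht => ?_, fun t ht => ?_⟩
  · obtain ⟨D, hDn, hD⟩ := b.exists_diagonal (fun i => Real.exp (-(l i * t))) (C := 1) (fun i => by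
      rw [abs_of_pos (Real.exp_pos _)]
      exact exp_neg_mul_le_one (hl i) ht) zero_le_one
    rw [hdiag D t ht hD]
    exact hDn
  -- B is formally (c + A)e^{-At}, bounded since l e^{-lt} ≤ 1/t; then e^{-At} = R B is compact.
  · obtain ⟨B, -, hB⟩ := b.exists_diagonal (fun i => (c + l i) * Real.exp (-(l i * t)))
      (C := |c| + t⁻¹) (fun i => by
        have e1 := exp_neg_mul_le_one (hl i) ht.le
        have e2 := Real.exp_pos (-(l i * t))
        have e3 : l i * Real.exp (-(l i * t)) ≤ t⁻¹ := by
          rw [Real.exp_neg, ← div_eq_mul_inv, div_le_iff₀ (Real.exp_pos _), ← div_eq_inv_mul,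
            le_div_iff₀ ht]
          linarith [Real.add_one_le_exp (l i * t)]
        have e4 : 0 ≤ l i * Real.exp (-(l i * t)) := mul_nonneg (hl i) e2.le
        rw [add_mul]
        refine (abs_add_le _ _).trans (add_le_add ?_ ?_)
        · rw [abs_mul, abs_of_pos e2]
          exact mul_le_of_le_one_right (abs_nonneg _) e1
        · rwa [abs_of_nonneg e4]) (by positivity)
    rw [hdiag (R ∘L B) t ht.le fun x i => by
      rw [ContinuousLinearMap.comp_apply, hR, hB, ← mul_assoc, ← mul_assoc,
        inv_mul_cancel₀ (hcl i), one_mul]]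
    exact hRc.comp_clm B

end Generation

/-! ### History segments and delayed forcing terms -/

section Segment

variable {H : Type*} [NormedAddCommGroup H]

/-- The history segment of a continuous function on the line. -/
def historySegment (r : ℝ) (w : C(ℝ, H)) (t : ℝ) : C(Icc (-r) 0, H) :=
  ⟨fun θ => w (t + θ), by fun_prop⟩

theorem continuous_historySegment_uncurry (r : ℝ) :
    Continuous fun p : C(ℝ, H) × ℝ => historySegment r p.1 p.2 :=
  ContinuousMap.continuous_of_continuous_uncurry _
    ((by fun_prop : Continuous fun p : (C(ℝ, H) × ℝ) × Icc (-r) 0 => p.1.1 (p.1.2 + p.2)))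

/-- The forcing term `s ↦ G(w_{s-ε})`. -/
def forcing {r : ℝ} (G : C(C(Icc (-r) 0, H), H)) (ε : ℝ) (w : C(ℝ, H)) : C(ℝ, H) :=
  ⟨fun s => G (historySegment r w (s - ε)), G.continuous.comp ((continuous_historySegment_uncurry r).comp
    ((by fun_prop : Continuous fun s : ℝ => (w, s - ε))))⟩

theorem continuous_forcing_uncurry {r : ℝ} (G : C(C(Icc (-r) 0, H), H)) :
    Continuous fun p : ℝ × C(ℝ, H) => forcing G p.1 p.2 :=
  ContinuousMap.continuous_of_continuous_uncurry _
    (G.continuous.comp ((continuous_historySegment_uncurry r).comp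
      ((by fun_prop : Continuous fun p : (ℝ × C(ℝ, H)) × ℝ => (p.1.2, p.2 - p.1.1)))))

/-- The delayed history never looks past time s, so ε drops out of the bound. The additive constant
a is absorbed because the weight is at least 1. -/
theorem norm_forcing_le {r : ℝ} {G : C(C(Icc (-r) 0, H), H)}
    {a b : ℝ} (ha : 0 ≤ a) (hb : 0 ≤ b) (hG : ∀ ψ, ‖G ψ‖ ≤ a + b * ‖ψ‖) {B ε : ℝ} (hB : 1 ≤ B)
    (hε : 0 ≤ ε) {w : C(ℝ, H)}
    (hw : ∀ t, ‖w t‖ ≤ B * Real.exp ((a + b + 1) * max t 0)) {s : ℝ} (hs : 0 ≤ s) :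
    ‖forcing G ε w s‖ ≤ (a + b + 1) * B * Real.exp ((a + b + 1) * s) := by
  have hE : 1 ≤ Real.exp ((a + b + 1) * s) := Real.one_le_exp (by positivity)
  have h1 : ‖historySegment r w (s - ε)‖ ≤ B * Real.exp ((a + b + 1) * s) := by
    refine (ContinuousMap.norm_le _ (by positivity)).2 fun θ => (hw _).trans ?_
    have := θ.2.2
    have : max (s - ε + θ) 0 ≤ s := max_le (by linarith) hs
    gcongr
  have hBE : 1 ≤ B * Real.exp ((a + b + 1) * s) := one_le_mul_of_one_le_of_one_le hB hE
  calc ‖forcing G ε w s‖ ≤ a + b * ‖historySegment r w (s - ε)‖ := hG _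
    _ ≤ a * (B * Real.exp ((a + b + 1) * s)) + b * (B * Real.exp ((a + b + 1) * s)) :=
        add_le_add (le_mul_of_one_le_right ha hBE) (mul_le_mul_of_nonneg_left h1 hb)
    _ ≤ (a + b + 1) * B * Real.exp ((a + b + 1) * s) := by nlinarith

end Segment

/-! ### Duhamel operator and global existence for compact semigroups -/

section AbstractExistence

variable {H : Type*} [NormedAddCommGroup H] [NormedSpace ℝ H]

/-- A strongly continuous contraction semigroup of operators that are compact at positive times. -/
structure IsCompactContractionSemigroup (S : ℝ → H →L[ℝ] H) : Prop where
  zero : S 0 = ContinuousLinearMap.id ℝ H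
  add : ∀ s t : ℝ, 0 ≤ s → 0 ≤ t → S (s + t) = (S s).comp (S t)
  strongly_continuous : ∀ x : H, ContinuousOn (fun t => S t x) (Ici 0)
  norm_le : ∀ t, 0 ≤ t → ‖S t‖ ≤ 1
  compact : ∀ t, 0 < t → IsCompactOperator (S t)

namespace IsCompactContractionSemigroup

variable {S : ℝ → H →L[ℝ] H} (hS : IsCompactContractionSemigroup S)

include hS

theorem norm_apply_le {t : ℝ} (ht : 0 ≤ t) (x : H) : ‖S t x‖ ≤ ‖x‖ :=
  ((S t).le_opNorm x).trans (mul_le_of_le_one_left (norm_nonneg _) (hS.norm_le t ht))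

/-- Strong continuity in time and the uniform Lipschitz constant 1 in space combine to joint
continuity; truncating time at 0 makes it global on ℝ × H. -/
theorem continuous_uncurry : Continuous fun p : ℝ × H => S (max p.1 0) p.2 := by
  have : Continuous fun p : H × ℝ => S (max p.2 0) p.1 := by
    refine continuous_prod_of_continuous_lipschitzWith _ 1 (fun x => ?_) fun t => ?_
    · exact (hS.strongly_continuous x).comp_continuous (by fun_prop)
        fun t => mem_Ici.2 (le_max_right t 0)
    · refine LipschitzWith.of_dist_le_mul fun x y => ?_
      rw [dist_eq_norm, dist_eq_norm, ← map_sub]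
      simpa using hS.norm_apply_le (le_max_right t 0) (x - y)
  exact this.comp continuous_swap

end IsCompactContractionSemigroup

/-- The convolution `∫₀ᵗ S(t-s) q(s) ds`, extended by `0` to negative times. -/
def duhamel (S : ℝ → H →L[ℝ] H) (q : C(ℝ, H)) (t : ℝ) : H :=
  ∫ s in (0 : ℝ)..max t 0, S (max (t - s) 0) (q s)

theorem duhamel_of_nonpos (S : ℝ → H →L[ℝ] H) (q : C(ℝ, H)) {t : ℝ} (ht : t ≤ 0) :
    duhamel S q t = 0 := by
  simp [duhamel, ht]

theorem duhamel_max (S : ℝ → H →L[ℝ] H) (q : C(ℝ, H)) (t : ℝ) :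
    duhamel S q (max t 0) = duhamel S q t := by
  rcases le_total t 0 with h | h
  · rw [max_eq_right h, duhamel_of_nonpos S q h, duhamel_of_nonpos S q le_rfl]
  · rw [max_eq_left h]

namespace IsCompactContractionSemigroup

variable {S : ℝ → H →L[ℝ] H} (hS : IsCompactContractionSemigroup S)

include hS

theorem continuous_integrand (q : C(ℝ, H)) (t : ℝ) :
    Continuous fun s => S (max (t - s) 0) (q s) :=
  hS.continuous_uncurry.comp ((by fun_prop : Continuous fun s => (t - s, q s)))

theorem continuous_duhamel_uncurry :
    Continuous fun p : C(ℝ, H) × ℝ => duhamel S p.1 p.2 := by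
  unfold duhamel
  refine intervalIntegral.continuous_parametric_intervalIntegral_of_continuous
    (f := fun (p : C(ℝ, H) × ℝ) s => S (max (p.2 - s) 0) (p.1 s)) ?_ (by fun_prop)
  exact hS.continuous_uncurry.comp
    ((by fun_prop : Continuous fun x : (C(ℝ, H) × ℝ) × ℝ => (x.1.2 - x.2, x.1.1 x.2)))

theorem norm_integral_le {q : C(ℝ, H)} {M a t : ℝ} (hat : a ≤ t)
    (hq : ∀ s ∈ Icc a t, ‖q s‖ ≤ M) :
    ‖∫ s in a..t, S (max (t - s) 0) (q s)‖ ≤ M * (t - a) := by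
  have := intervalIntegral.norm_integral_le_of_norm_le_const (a := a) (b := t) (C := M)
    (f := fun s => S (max (t - s) 0) (q s)) (fun s hs => by
      rw [uIoc_of_le hat] at hs
      exact (hS.norm_apply_le (le_max_right _ _) _).trans (hq s ⟨hs.1.le, hs.2⟩))
  rwa [abs_of_nonneg (sub_nonneg.2 hat)] at this

theorem norm_duhamel_le {q : C(ℝ, H)} {M t : ℝ} (ht : 0 ≤ t) (hq : ∀ s ∈ Icc 0 t, ‖q s‖ ≤ M) :
    ‖duhamel S q t‖ ≤ M * t := by
  rw [duhamel, max_eq_left ht]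
  simpa using hS.norm_integral_le ht hq

/-- The semigroup law pulled through the integral. With a = t - δ, the past is smoothed by the
compact operator S δ and the remainder is O(δ); both compactness arguments below rest on this
splitting. -/
theorem duhamel_eq_add [CompleteSpace H] (q : C(ℝ, H)) {a t : ℝ} (ha : 0 ≤ a) (hat : a ≤ t) :
    duhamel S q t =
      S (t - a) (duhamel S q a) + ∫ s in a..t, S (max (t - s) 0) (q s) := by
  have hi : ∀ t u v, IntervalIntegrable (fun s => S (max (t - s) 0) (q s)) volume u v :=
    fun t u v => (hS.continuous_integrand q t).intervalIntegrable _ _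
  rw [duhamel, duhamel, max_eq_left (ha.trans hat), max_eq_left ha,
    ← intervalIntegral.integral_add_adjacent_intervals (hi t 0 a) (hi t a t),
    ← ContinuousLinearMap.intervalIntegral_comp_comm _ (hi a 0 a)]
  congr 1
  refine intervalIntegral.integral_congr fun s hs => ?_
  rw [uIcc_of_le ha] at hs
  rw [← ContinuousLinearMap.comp_apply, ← hS.add _ _ (sub_nonneg.2 hat) (le_max_right _ _),
    max_eq_left (sub_nonneg.2 hs.2), max_eq_left (sub_nonneg.2 (hs.2.trans hat))]
  congr 2
  ring

theorem isCompact_closure_image (t : ℝ) (ht : 0 < t) (C : ℝ) :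
    IsCompact (closure (S t '' Metric.closedBall 0 C)) :=
  (hS.compact t ht).isCompact_closure_image_closedBall C

/-- Up to an error M δ < ε/2, every value lies in the image under S δ of one fixed ball. -/
theorem totallyBounded_duhamel [CompleteSpace H] {M t : ℝ} (ht : 0 ≤ t) (hM : 0 ≤ M) :
    TotallyBounded {x | ∃ q : C(ℝ, H), (∀ s ∈ Icc 0 t, ‖q s‖ ≤ M) ∧ duhamel S q t = x} := by
  rw [Metric.totallyBounded_iff]
  intro ε hε
  rcases ht.eq_or_lt with rfl | ht0
  · refine ⟨{0}, finite_singleton _, ?_⟩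
    rintro x ⟨q, -, rfl⟩
    simpa [duhamel_of_nonpos] using hε
  obtain ⟨δ, hδ0, hδt, hδ⟩ : ∃ δ, 0 < δ ∧ δ ≤ t ∧ M * δ < ε / 2 := by
    refine ⟨min t (ε / (4 * (M + 1))), by positivity, min_le_left _ _, ?_⟩
    calc M * min t (ε / (4 * (M + 1))) ≤ (M + 1) * (ε / (4 * (M + 1))) :=
          mul_le_mul (by linarith) (min_le_right _ _) (by positivity) (by positivity)
      _ = ε / 4 := by field_simp
      _ < ε / 2 := by linarith
  obtain ⟨F, hF, hcov⟩ := Metric.totallyBounded_iff.1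
    (hS.isCompact_closure_image δ hδ0 (M * t)).totallyBounded (ε / 2) (half_pos hε)
  refine ⟨F, hF, ?_⟩
  rintro x ⟨q, hq, rfl⟩
  have ha : 0 ≤ t - δ := sub_nonneg.2 hδt
  have hmem : S δ (duhamel S q (t - δ)) ∈ closure (S δ '' Metric.closedBall 0 (M * t)) := by
    refine subset_closure ⟨_, ?_, rfl⟩
    rw [mem_closedBall_zero_iff]
    exact (hS.norm_duhamel_le ha fun s hs => hq s ⟨hs.1, hs.2.trans (by linarith)⟩).trans
      (mul_le_mul_of_nonneg_left (by linarith) hM)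
  obtain ⟨y, hy, hxy⟩ := mem_iUnion₂.1 (hcov hmem)
  refine mem_iUnion₂.2 ⟨y, hy, ?_⟩
  have hdec := hS.duhamel_eq_add q ha (sub_le_self t hδ0.le)
  have hrem := hS.norm_integral_le (sub_le_self t hδ0.le) fun s hs => hq s ⟨ha.trans hs.1, hs.2⟩
  rw [sub_sub_cancel] at hdec hrem
  have : dist (duhamel S q t) (S δ (duhamel S q (t - δ))) < ε / 2 := by
    rw [dist_eq_norm, hdec, add_sub_cancel_left]
    exact hrem.trans_lt hδ
  exact (dist_triangle _ _ _).trans_lt (by linarith [Metric.mem_ball.1 hxy])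

/-- For t ≤ δ the value itself is small. For t ≥ δ it is a point of a fixed compact set plus a small
remainder, and S τ tends to the identity uniformly on compact sets. -/
theorem uniform_equicontinuity_duhamel [CompleteSpace H] {M T : ℝ} (hM : 0 ≤ M)
    {ε : ℝ} (hε : 0 < ε) :
    ∃ τ > 0, ∀ q : C(ℝ, H), (∀ s ∈ Icc 0 T, ‖q s‖ ≤ M) → ∀ t t', 0 ≤ t → t ≤ t' → t' ≤ T →
      t' - t ≤ τ → ‖duhamel S q t' - duhamel S q t‖ ≤ ε := by
  obtain ⟨δ, hδ0, hδ⟩ : ∃ δ, 0 < δ ∧ M * δ ≤ ε / 4 := by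
    refine ⟨ε / (4 * (M + 1)), by positivity, ?_⟩
    calc M * (ε / (4 * (M + 1))) ≤ (M + 1) * (ε / (4 * (M + 1))) :=
          mul_le_mul_of_nonneg_right (by linarith) (by positivity)
      _ = ε / 4 := by field_simp
  have hev : ∀ᶠ τ in 𝓝 (0 : ℝ), ∀ y ∈ closure (S δ '' Metric.closedBall 0 (M * T)),
      ‖S (max τ 0) y - y‖ < ε / 4 := by
    refine (hS.isCompact_closure_image δ hδ0 (M * T)).eventually_forall_of_forall_eventually
      fun y _ => ?_
    have hc : Continuous fun p : ℝ × H => ‖S (max p.1 0) p.2 - p.2‖ :=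
      (hS.continuous_uncurry.sub continuous_snd).norm
    refine hc.continuousAt.eventually_lt continuousAt_const ?_
    simp [hS.zero]
    positivity
  obtain ⟨τ, hτ0, hτ⟩ := Metric.eventually_nhds_iff.1 hev
  refine ⟨min δ (τ / 2), by positivity, fun q hq t t' ht htt' ht'T hd => ?_⟩
  have hdδ : t' - t ≤ δ := hd.trans (min_le_left _ _)
  have h0 : 0 ≤ t' - t := sub_nonneg.2 htt'
  have hdec := hS.duhamel_eq_add q ht htt'
  have hrem : ‖∫ s in t..t', S (max (t' - s) 0) (q s)‖ ≤ ε / 4 :=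
    (hS.norm_integral_le htt' fun s hs => hq s ⟨ht.trans hs.1, hs.2.trans ht'T⟩).trans
      ((mul_le_mul_of_nonneg_left hdδ hM).trans hδ)
  have hmain : ‖S (t' - t) (duhamel S q t) - duhamel S q t‖ ≤ 3 * (ε / 4) := by
    rcases le_total t δ with htδ | htδ
    · have h1 : ‖duhamel S q t‖ ≤ ε / 4 :=
        (hS.norm_duhamel_le ht fun s hs => hq s ⟨hs.1, hs.2.trans (htt'.trans ht'T)⟩).trans
          ((mul_le_mul_of_nonneg_left htδ hM).trans hδ)
      have h2 := hS.norm_apply_le h0 (duhamel S q t)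
      linarith [norm_sub_le (S (t' - t) (duhamel S q t)) (duhamel S q t)]
    · have ha : 0 ≤ t - δ := sub_nonneg.2 htδ
      have hdec2 := hS.duhamel_eq_add q ha (sub_le_self t hδ0.le)
      have hrem2 := hS.norm_integral_le (sub_le_self t hδ0.le)
        fun s hs => hq s ⟨ha.trans hs.1, hs.2.trans (htt'.trans ht'T)⟩
      rw [sub_sub_cancel] at hdec2 hrem2
      have hmem : S δ (duhamel S q (t - δ)) ∈ closure (S δ '' Metric.closedBall 0 (M * T)) := by
        refine subset_closure ⟨_, ?_, rfl⟩
        rw [mem_closedBall_zero_iff]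
        exact (hS.norm_duhamel_le ha fun s hs => hq s ⟨hs.1, hs.2.trans (by linarith)⟩).trans
          (mul_le_mul_of_nonneg_left (by linarith) hM)
      have hK := hτ (y := t' - t) (by
        rw [Real.dist_eq, sub_zero, abs_of_nonneg h0]
        linarith [min_le_right δ (τ / 2)]) _ hmem
      rw [max_eq_left h0] at hK
      set y := S δ (duhamel S q (t - δ))
      set z := ∫ s in (t - δ)..t, S (max (t - s) 0) (q s)
      have h2 := hS.norm_apply_le h0 z
      rw [hdec2, map_add]
      calc ‖S (t' - t) y + S (t' - t) z - (y + z)‖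
          = ‖(S (t' - t) y - y) + (S (t' - t) z - z)‖ := by congr 1; abel
        _ ≤ ‖S (t' - t) y - y‖ + (‖S (t' - t) z‖ + ‖z‖) :=
          (norm_add_le _ _).trans (by gcongr; exact norm_sub_le _ _)
        _ ≤ 3 * (ε / 4) := by linarith
  rw [hdec]
  calc ‖S (t' - t) (duhamel S q t) + (∫ s in t..t', S (max (t' - s) 0) (q s)) - duhamel S q t‖
      = ‖(S (t' - t) (duhamel S q t) - duhamel S q t) +
          ∫ s in t..t', S (max (t' - s) 0) (q s)‖ := by congr 1; abel
    _ ≤ 3 * (ε / 4) + ε / 4 := (norm_add_le _ _).trans (add_le_add hmain hrem)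
    _ = ε := by ring

/-- `duhamel` as a map of spaces of continuous functions. -/
def duhamelMap (q : C(ℝ, H)) : C(ℝ, H) :=
  ⟨duhamel S q, hS.continuous_duhamel_uncurry.comp (Continuous.prodMk_right q)⟩

theorem continuous_duhamelMap : Continuous hS.duhamelMap :=
  ContinuousMap.continuous_of_continuous_uncurry _ hS.continuous_duhamel_uncurry

/-- Arzelà-Ascoli for the compact-open topology on C(ℝ, H). Monotonicity of M lets the bound on [0,
t] be read off at t. -/
theorem isCompact_closure_duhamelMap [CompleteSpace H] {M : ℝ → ℝ} (hM : Monotone M)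
    (hM0 : ∀ t, 0 ≤ M t) :
    IsCompact (closure (hS.duhamelMap '' {q | ∀ s, 0 ≤ s → ‖q s‖ ≤ M s})) := by
  have : T2Space (UniformOnFun ℝ H {K : Set ℝ | IsCompact K}) :=
    UniformOnFun.t2Space_of_covering
      (eq_univ_iff_forall.2 fun x => mem_sUnion_of_mem (mem_singleton x) isCompact_singleton)
  refine ArzelaAscoli.isCompact_closure_of_isClosedEmbedding (𝔖 := {K : Set ℝ | IsCompact K})
    (F := fun w : C(ℝ, H) => (w : ℝ → H)) (fun K hK => hK)
    (ContinuousMap.isUniformEmbedding_toUniformOnFunIsCompact (α := ℝ) (β := H)).isClosedEmbedding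
    ?_ ?_
  · intro K _
    refine Equicontinuous.equicontinuousOn ?_ K
    intro x
    rw [Metric.equicontinuousAt_iff]
    intro ε hε
    -- The added 1 matches the cap `min τ 1`, keeping both clipped times below T.
    set T := max x 0 + 1
    have hT : 0 ≤ T := by positivity
    obtain ⟨τ, hτ0, hτ⟩ := hS.uniform_equicontinuity_duhamel (hM0 T) (half_pos hε)
    refine ⟨min τ 1, by positivity, fun y hy => ?_⟩
    rintro ⟨_, q, hq, rfl⟩
    have hqT : ∀ s ∈ Icc 0 T, ‖q s‖ ≤ M T := fun s hs => (hq s hs.1).trans (hM hs.2)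
    rw [Real.dist_eq] at hy
    have hxy : |max y 0 - max x 0| < min τ 1 :=
      (abs_max_sub_max_le_abs y x 0).trans_lt hy
    have h1 := abs_lt.1 (hxy.trans_le (min_le_left _ _))
    have h2 := abs_lt.1 (hxy.trans_le (min_le_right _ _))
    simp only [Function.comp_apply, duhamelMap, ContinuousMap.coe_mk]
    rw [← duhamel_max S q x, ← duhamel_max S q y]
    refine lt_of_le_of_lt ?_ (half_lt_self hε)
    rcases le_total (max x 0) (max y 0) with h | h
    · rw [dist_comm, dist_eq_norm]
      exact hτ q hqT _ _ (le_max_right _ _) h (by simp only [T]; linarith) (by linarith)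
    · rw [dist_eq_norm]
      exact hτ q hqT _ _ (le_max_right _ _) h (by simp only [T]; linarith) (by linarith)
  · intro K _ x _
    refine ⟨_, (hS.totallyBounded_duhamel (le_max_right x 0)
      (hM0 (max x 0))).closure.isCompact_of_isClosed isClosed_closure, ?_⟩
    rintro _ ⟨q, hq, rfl⟩
    exact subset_closure ⟨q, fun s hs => (hq s hs.1).trans (hM hs.2), duhamel_max S q x⟩

end IsCompactContractionSemigroup

/-! ### Delayed Picard iteration and passage to the limit -/

namespace IsCompactContractionSemigroup

variable {S : ℝ → H →L[ℝ] H} (hS : IsCompactContractionSemigroup S)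

/-- The solution of the homogeneous problem with initial function `φ`, extended to the left by a
constant. -/
def freeEvolution {r : ℝ} (hr : -r ≤ 0) (φ : C(Icc (-r) 0, H)) : C(ℝ, H) :=
  ⟨fun t => IccExtend hr φ t + (S (max t 0) (φ ⟨0, hr, le_rfl⟩) - φ ⟨0, hr, le_rfl⟩),
    (φ.continuous.Icc_extend').add ((hS.continuous_uncurry.comp
      ((by fun_prop : Continuous fun t : ℝ => (t, φ ⟨0, hr, le_rfl⟩)))).sub continuous_const)⟩

theorem freeEvolution_of_nonneg {r : ℝ} (hr : -r ≤ 0) (φ : C(Icc (-r) 0, H)) {t : ℝ}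
    (ht : 0 ≤ t) : hS.freeEvolution hr φ t = S t (φ ⟨0, hr, le_rfl⟩) := by
  simp [freeEvolution, IccExtend_of_right_le hr φ ht, max_eq_left ht]

theorem freeEvolution_of_nonpos {r : ℝ} (hr : -r ≤ 0) (φ : C(Icc (-r) 0, H)) {t : ℝ}
    (ht : t ≤ 0) : hS.freeEvolution hr φ t = IccExtend hr φ t := by
  simp [freeEvolution, max_eq_right ht, hS.zero]

theorem norm_freeEvolution_le {r : ℝ} (hr : -r ≤ 0) (φ : C(Icc (-r) 0, H)) (t : ℝ) :
    ‖hS.freeEvolution hr φ t‖ ≤ ‖φ‖ := by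
  rcases le_total t 0 with h | h
  · rw [hS.freeEvolution_of_nonpos hr φ h]
    exact φ.norm_coe_le_norm _
  · rw [hS.freeEvolution_of_nonneg hr φ h]
    exact (hS.norm_apply_le h _).trans (φ.norm_coe_le_norm _)

/-- The right hand side of the variation of constants formula, with the history delayed by `ε`. -/
def picard {r : ℝ} (hr : -r ≤ 0) (G : C(C(Icc (-r) 0, H), H)) (φ : C(Icc (-r) 0, H)) (ε : ℝ)
    (w : C(ℝ, H)) : C(ℝ, H) :=
  hS.freeEvolution hr φ + hS.duhamelMap (forcing G ε w)

theorem picard_apply {r : ℝ} (hr : -r ≤ 0) (G : C(C(Icc (-r) 0, H), H)) (φ : C(Icc (-r) 0, H))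
    (ε : ℝ) (w : C(ℝ, H)) (t : ℝ) : hS.picard hr G φ ε w t =
      hS.freeEvolution hr φ t + duhamel S (forcing G ε w) t := rfl

theorem continuous_picard_uncurry {r : ℝ} (hr : -r ≤ 0) (G : C(C(Icc (-r) 0, H), H))
    (φ : C(Icc (-r) 0, H)) : Continuous fun p : ℝ × C(ℝ, H) => hS.picard hr G φ p.1 p.2 :=
  continuous_const.add (hS.continuous_duhamelMap.comp (continuous_forcing_uncurry G))

/-- The forcing at time s sees w only up to s - ε, so agreement up to a propagates to a + ε.
Consequently each Picard iteration settles one more interval of length ε. -/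
theorem eqOn_picard {r : ℝ} (hr : -r ≤ 0) (G : C(C(Icc (-r) 0, H), H))
    (φ : C(Icc (-r) 0, H)) {ε a : ℝ} {w w' : C(ℝ, H)} (h : EqOn w w' (Iic a)) :
    EqOn (hS.picard hr G φ ε w) (hS.picard hr G φ ε w') (Iic (a + ε)) := by
  intro t ht
  rw [picard_apply, picard_apply]
  congr 1
  rcases le_total t 0 with h0 | h0
  · rw [duhamel_of_nonpos _ _ h0, duhamel_of_nonpos _ _ h0]
  · refine intervalIntegral.integral_congr fun s hs => ?_
    rw [max_eq_left h0, uIcc_of_le h0] at hs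
    have : historySegment r w (s - ε) = historySegment r w' (s - ε) := by
      ext θ
      refine h ?_
      have := θ.2.2
      have := mem_Iic.1 ht
      exact mem_Iic.2 (by linarith [hs.2])
    simp [forcing, this]

theorem eqOn_iterate_picard {r : ℝ} (hr : -r ≤ 0) (G : C(C(Icc (-r) 0, H), H))
    (φ : C(Icc (-r) 0, H)) (ε : ℝ) (k : ℕ) :
    EqOn ((hS.picard hr G φ ε)^[k + 1] (hS.freeEvolution hr φ))
      ((hS.picard hr G φ ε)^[k] (hS.freeEvolution hr φ)) (Iic (k * ε)) := by
  induction k with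
  | zero =>
    intro t ht
    rw [Function.iterate_one, picard_apply, duhamel_of_nonpos _ _ (by simpa using ht)]
    simp
  | succ k ih =>
    have := hS.eqOn_picard hr G φ (ε := ε) ih
    rwa [show (k : ℝ) * ε + ε = ((k + 1 : ℕ) : ℝ) * ε by push_cast; ring,
      ← Function.iterate_succ_apply' (hS.picard hr G φ ε),
      ← Function.iterate_succ_apply' (hS.picard hr G φ ε)] at this

/-- The exponent a + b + 1 is chosen so that, with B = ‖φ‖ + 1, the forcing bound integrates exactly
to B e^{(a+b+1)t} - B; the spare B covers the free evolution. -/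
theorem norm_picard_le {r : ℝ} (hr : -r ≤ 0) {G : C(C(Icc (-r) 0, H), H)}
    {φ : C(Icc (-r) 0, H)} {a b : ℝ} (ha : 0 ≤ a) (hb : 0 ≤ b)
    (hG : ∀ ψ, ‖G ψ‖ ≤ a + b * ‖ψ‖) {ε : ℝ} (hε : 0 ≤ ε) {w : C(ℝ, H)}
    (hw : ∀ t, ‖w t‖ ≤ (‖φ‖ + 1) * Real.exp ((a + b + 1) * max t 0)) (t : ℝ) :
    ‖hS.picard hr G φ ε w t‖ ≤ (‖φ‖ + 1) * Real.exp ((a + b + 1) * max t 0) := by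
  have hB : 1 ≤ ‖φ‖ + 1 := by linarith [norm_nonneg φ]
  have hint : ‖duhamel S (forcing G ε w) t‖ ≤
      ∫ s in (0 : ℝ)..max t 0, (a + b + 1) * (‖φ‖ + 1) * Real.exp ((a + b + 1) * s) := by
    refine intervalIntegral.norm_integral_le_of_norm_le (le_max_right _ _) ?_
      (Continuous.intervalIntegrable (by fun_prop) _ _)
    refine Eventually.of_forall fun s hs => ?_
    exact (hS.norm_apply_le (le_max_right _ _) _).trans
      (norm_forcing_le ha hb hG hB hε hw hs.1.le)
  have hval : ∫ s in (0 : ℝ)..max t 0, (a + b + 1) * (‖φ‖ + 1) * Real.exp ((a + b + 1) * s) =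
      (‖φ‖ + 1) * Real.exp ((a + b + 1) * max t 0) - (‖φ‖ + 1) := by
    rw [intervalIntegral.integral_eq_sub_of_hasDerivAt
      (f := fun s => (‖φ‖ + 1) * Real.exp ((a + b + 1) * s))]
    · simp
    · intro s _
      have := (((hasDerivAt_id s).const_mul (a + b + 1)).exp).const_mul (‖φ‖ + 1)
      rw [show (a + b + 1) * (‖φ‖ + 1) * Real.exp ((a + b + 1) * s) =
        (‖φ‖ + 1) * (Real.exp ((a + b + 1) * s) * ((a + b + 1) * 1)) by ring]
      exact this
    · exact Continuous.intervalIntegrable (by fun_prop) _ _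
  rw [picard_apply]
  refine (norm_add_le _ _).trans ?_
  linarith [hS.norm_freeEvolution_le hr φ t]

theorem norm_iterate_picard_le {r : ℝ} (hr : -r ≤ 0) {G : C(C(Icc (-r) 0, H), H)}
    {φ : C(Icc (-r) 0, H)} {a b : ℝ} (ha : 0 ≤ a) (hb : 0 ≤ b)
    (hG : ∀ ψ, ‖G ψ‖ ≤ a + b * ‖ψ‖) {ε : ℝ} (hε : 0 ≤ ε) (k : ℕ) (t : ℝ) :
    ‖(hS.picard hr G φ ε)^[k] (hS.freeEvolution hr φ) t‖ ≤
      (‖φ‖ + 1) * Real.exp ((a + b + 1) * max t 0) := by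
  induction k generalizing t with
  | zero =>
    have h1 : 1 ≤ Real.exp ((a + b + 1) * max t 0) := Real.one_le_exp (by positivity)
    have h2 := hS.norm_freeEvolution_le hr φ t
    simp only [Function.iterate_zero, id_eq]
    nlinarith [norm_nonneg φ]
  | succ k ih =>
    rw [Function.iterate_succ_apply']
    exact hS.norm_picard_le hr ha hb hG hε ih t

/-- Solutions of the delayed equations on `(-∞, n]`, with a bound that does not depend on `n`. -/
theorem exists_approximate_solution {r : ℝ} (hr : -r ≤ 0) {G : C(C(Icc (-r) 0, H), H)}
    {φ : C(Icc (-r) 0, H)} {a b : ℝ} (ha : 0 ≤ a) (hb : 0 ≤ b)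
    (hG : ∀ ψ, ‖G ψ‖ ≤ a + b * ‖ψ‖) (n : ℕ) :
    ∃ w : C(ℝ, H), (∀ t, ‖w t‖ ≤ (‖φ‖ + 1) * Real.exp ((a + b + 1) * max t 0)) ∧
      EqOn (hS.picard hr G φ (1 / ((n : ℝ) + 1)) (hS.picard hr G φ (1 / ((n : ℝ) + 1)) w))
        (hS.picard hr G φ (1 / ((n : ℝ) + 1)) w) (Iic n) := by
  -- After n(n+1) + 1 steps of length 1/(n+1) the iterates are stationary past time n. The
  -- fixed-point relation is stated for the image of w, since that image is what lies in a translate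
  -- of the compact set.
  refine ⟨_, hS.norm_iterate_picard_le hr ha hb hG (by positivity : 0 ≤ 1 / ((n : ℝ) + 1))
    (n * (n + 1)), ?_⟩
  have := hS.eqOn_iterate_picard hr G φ (1 / ((n : ℝ) + 1)) (n * (n + 1) + 1)
  rw [Function.iterate_succ_apply', Function.iterate_succ_apply'] at this
  refine this.mono fun t ht => (mem_Iic.1 ht).trans ?_
  rw [mul_one_div, le_div_iff₀ (by positivity)]
  push_cast
  linarith

/-- Global existence for the variation of constants formula with a continuous functional `G` of
linear growth. -/
theorem exists_global_solution [CompleteSpace H] {r : ℝ} (hr : -r ≤ 0)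
    (G : C(C(Icc (-r) 0, H), H)) {a b : ℝ} (ha : 0 ≤ a) (hb : 0 ≤ b)
    (hG : ∀ ψ, ‖G ψ‖ ≤ a + b * ‖ψ‖) (φ : C(Icc (-r) 0, H)) :
    ∃ u : C(ℝ, H), ∀ t, u t = hS.freeEvolution hr φ t + duhamel S (forcing G 0 u) t := by
  choose w hw hfix using hS.exists_approximate_solution hr (φ := φ) ha hb hG
  have hM : Monotone fun s : ℝ => (a + b + 1) * (‖φ‖ + 1) * Real.exp ((a + b + 1) * s) := by
    intro s t hst
    have : 0 ≤ (a + b + 1) * (‖φ‖ + 1) := by positivity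
    dsimp only
    gcongr
  have hcpt := hS.isCompact_closure_duhamelMap hM fun t => by positivity
  obtain ⟨v, -, σ, hσ, hv⟩ := hcpt.tendsto_subseq
    (x := fun n : ℕ => hS.duhamelMap (forcing G (1 / ((n : ℝ) + 1)) (w n))) fun n =>
      subset_closure (mem_image_of_mem _ fun s hs =>
        norm_forcing_le ha hb hG (by linarith [norm_nonneg φ]) (by positivity) (hw n) hs)
  have hε : Tendsto (fun n => 1 / ((σ n : ℝ) + 1)) atTop (𝓝 0) :=
    tendsto_one_div_add_atTop_nhds_zero_nat.comp hσ.tendsto_atTop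
  have hU : Tendsto (fun n => hS.picard hr G φ (1 / ((σ n : ℝ) + 1)) (w (σ n))) atTop
      (𝓝 (hS.freeEvolution hr φ + v)) := tendsto_const_nhds.add hv
  have hP := ((hS.continuous_picard_uncurry hr G φ).tendsto (0, hS.freeEvolution hr φ + v)).comp
    (hε.prodMk_nhds hU)
  refine ⟨hS.freeEvolution hr φ + v, fun t => ?_⟩
  have ev : ∀ w : C(ℝ, H), Tendsto (fun f : C(ℝ, H) => f t) (𝓝 w) (𝓝 (w t)) := fun w =>
    (continuous_eval_const t).tendsto w
  refine tendsto_nhds_unique ((ev _).comp hU) (((ev _).comp hP).congr' ?_)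
  -- At a fixed t the approximate equation is exact as soon as σ n ≥ t.
  filter_upwards [hσ.tendsto_atTop.eventually_ge_atTop (⌈t⌉₊)] with n hn
  exact hfix (σ n) (mem_Iic.2 ((Nat.le_ceil t).trans (by exact_mod_cast hn)))

end IsCompactContractionSemigroup

end AbstractExistence

/-! ### Total variation of the Lebesgue-Stieltjes vector measure -/

section Variation

theorem edist_rightLim_le_eVariationOn {α : Type*} [LinearOrder α] [TopologicalSpace α]
    [OrderTopology α] {E : Type*} [NormedAddCommGroup E] [CompleteSpace E] {f : α → E}
    (hf : BoundedVariationOn f univ) (a : α) :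
    edist (f.rightLim a) (f a) ≤ eVariationOn f univ := by
  rcases eq_or_neBot (𝓝[>] a) with h | h
  · rw [rightLim_eq_of_eq_bot f h, edist_self]
    exact zero_le
  · exact le_of_tendsto ((hf.tendsto_rightLim a).edist tendsto_const_nhds)
      (Eventually.of_forall fun x => eVariationOn.edist_le f (mem_univ _) (mem_univ _))

variable {α : Type*} [LinearOrder α] [DenselyOrdered α] [TopologicalSpace α] [OrderTopology α]
  [SecondCountableTopology α] [CompactIccSpace α] [hα : MeasurableSpace α] [BorelSpace α]
  {E : Type*} [NormedAddCommGroup E] [CompleteSpace E] {f : α → E}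

/-- The total mass of the Lebesgue-Stieltjes measure is controlled by the total variation. -/
theorem variation_vectorMeasure_univ_le (hf : BoundedVariationOn f univ) {b t : α}
    (hb : IsBot b) (ht : IsTop t) :
    hf.vectorMeasure.variation univ ≤ 2 * eVariationOn f univ := by
  have : Nonempty α := ⟨b⟩
  -- The positive measure of the cumulative variation of `f.rightLim`; it dominates the increments
  -- and ignores the bottom point.
  set m₀ := (hf.stieltjesFunctionRightLim b).measure
  have huniv : (univ : Set α) = {b} ∪ Ioc b t := by
    ext x
    simp only [mem_univ, mem_union, mem_singleton_iff, mem_Ioc, true_iff]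
    rcases (hb x).eq_or_lt with h | h
    · exact Or.inl h.symm
    · exact Or.inr ⟨h, ht x⟩
  have hm₀b : m₀ {b} = 0 := by
    rw [← botSet_eq_singleton_of_isBot hb]
    exact StieltjesFunction.measure_botSet _
  have hvar : ∀ u v, u ≤ v → m₀ (Ioc u v) = eVariationOn f.rightLim (Icc u v) := by
    intro u v huv
    simp only [m₀, StieltjesFunction.measure_Ioc,
      BoundedVariationOn.stieltjesFunctionRightLim_apply]
    rw [← variationOnFromTo.add hf.rightLim.locallyBoundedVariationOn
      (mem_univ b) (mem_univ u) (mem_univ v)]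
    simp only [add_sub_cancel_left, variationOnFromTo, huv, ↓reduceIte, univ_inter]
    exact ENNReal.ofReal_toReal ((eVariationOn.mono _ (subset_univ _)).trans_lt hf.rightLim.lt_top).ne
  have hm₀univ : m₀ univ ≤ eVariationOn f univ := by
    refine (congrArg m₀ huniv).le.trans ((measure_union_le _ _).trans ?_)
    rw [hm₀b, zero_add, hvar b t (hb t)]
    exact (eVariationOn.mono _ (subset_univ _)).trans (eVariationOn.eVariationOn_rightLim_le isOpen_univ)
  have : IsFiniteMeasure m₀ := ⟨hm₀univ.trans_lt hf.lt_top⟩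
  have hgen : hα = MeasurableSpace.generateFrom {s | ∃ u v, u ≤ v ∧ s = Ioc u v} := by
    borelize α
    convert! borel_eq_generateFrom_Ioc_le α using 2
    grind only
  obtain ⟨m, hm, hmle⟩ :=
    VectorMeasure.exists_extension_of_isSetSemiring_of_le_measure_of_generateFrom (μ := m₀)
      (m := AddContent.onIoc f.rightLim) IsSetSemiring.Ioc (by
        rintro s ⟨u, v, huv, rfl⟩
        rw [AddContent.onIoc_apply huv, hvar u v huv, ← edist_eq_enorm_sub]
        exact eVariationOn.edist_le _ ⟨huv, le_rfl⟩ ⟨le_rfl, huv⟩) hgen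
  have hmIoc : ∀ u v, u ≤ v → m (Ioc u v) = f.rightLim v - f.rightLim u := by
    intro u v huv
    rw [hm _ ⟨u, v, huv, rfl⟩, AddContent.onIoc_apply huv]
  have hmb : m {b} = 0 := by
    rw [← enorm_eq_zero, ← le_zero_iff]
    exact (hmle _).trans hm₀b.le
  -- Half-open intervals never contain the bottom point b, so the jump there enters as a separate
  -- atom. Each summand has mass at most the variation of f, whence the factor 2.
  have heq : hf.vectorMeasure = m + VectorMeasure.dirac b (f.rightLim b - f b) := by
    refine VectorMeasure.ext_of_generateFrom _ ?_ hgen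
      (fun s hs t ht _ => IsSetSemiring.Ioc.inter_mem s hs t ht) ?_
    · rintro s ⟨u, v, huv, rfl⟩
      rw [hf.vectorMeasure_Ioc huv]
      change _ = m (Ioc u v) + VectorMeasure.dirac b (f.rightLim b - f b) (Ioc u v)
      rw [VectorMeasure.dirac_apply_of_notMem (fun h => (hb u).not_gt h.1), hmIoc u v huv, add_zero]
    · have hd : Disjoint {b} (Ioc b t) := by simp
      have h1 : m univ = f.rightLim t - f.rightLim b := by
        rw [huniv, VectorMeasure.of_union hd (measurableSet_singleton b) measurableSet_Ioc, hmb,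
          zero_add, hmIoc b t (hb t)]
      have h2 : hf.vectorMeasure univ = f.rightLim t - f b := by
        rw [huniv, VectorMeasure.of_union hd (measurableSet_singleton b) measurableSet_Ioc,
          hf.vectorMeasure_singleton, hf.vectorMeasure_Ioc (hb t),
          leftLim_eq_of_isBot hb]
        abel
      change _ = m univ + VectorMeasure.dirac b (f.rightLim b - f b) univ
      rw [VectorMeasure.dirac_apply_of_mem MeasurableSet.univ (mem_univ _), h1, h2]
      abel
  have hmvar : m.variation ≤ m₀ := VectorMeasure.variation_le_of_forall_enorm_le fun s _ => hmle s
  calc hf.vectorMeasure.variation univ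
      ≤ (m.variation + (VectorMeasure.dirac b (f.rightLim b - f b)).variation) univ := by
        rw [heq]
        exact VectorMeasure.variation_add_le univ
    _ ≤ eVariationOn f univ + eVariationOn f univ := by
        rw [Measure.add_apply]
        refine add_le_add ((hmvar univ).trans hm₀univ) ?_
        rw [VectorMeasure.variation_dirac]
        simp only [Measure.smul_apply, Measure.dirac_apply_of_mem (mem_univ b), smul_eq_mul,
          mul_one]
        rw [← edist_eq_enorm_sub]
        exact edist_rightLim_le_eVariationOn hf b
    _ = 2 * eVariationOn f univ := (two_mul _).symm

end Variation

theorem abs_integral_vectorMeasure_le {X : Type*} [MeasurableSpace X] {μ : VectorMeasure X ℝ}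
    [IsFiniteMeasure μ.variation] {p : X → ℝ} {C : ℝ} (hC : 0 ≤ C) (hp : ∀ x, |p x| ≤ C) :
    |∫ᵛ x, p x ∂•μ| ≤ C * μ.variation.real univ := by
  have h := VectorMeasure.norm_integral_le_of_norm_le_const (μ := μ) (f := p)
    (B := ContinuousLinearMap.lsmul ℝ ℝ) (Eventually.of_forall hp)
  refine h.trans ?_
  have : ‖(ContinuousLinearMap.lsmul ℝ ℝ : ℝ →L[ℝ] ℝ →L[ℝ] ℝ)‖ ≤ 1 :=
    ContinuousLinearMap.opNorm_lsmul_le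
  gcongr
  exact mul_le_of_le_one_right hC this

/-! ### Step approximation of continuous functions -/

section StepPartition

/-- A partition of `[-r,0]` into a point and half-open intervals on which a continuous function is
almost constant. -/
theorem exists_step_partition {r : ℝ} (hr : -r ≤ 0) {E : Type*} [PseudoMetricSpace E]
    (p : C(Icc (-r) 0, E)) {ε : ℝ} (hε : 0 < ε) :
    ∃ (N : ℕ) (A : ℕ → Set (Icc (-r) 0)) (a b s : ℕ → Icc (-r) 0),
      (∀ i, a i ≤ b i ∧ (A i = Icc (a i) (b i) ∨ A i = Ioc (a i) (b i))) ∧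
      ∀ θ, ∃ i, dist (p θ) (p (s i)) ≤ ε ∧
        ∀ F : ℕ → ℝ, ∑ j ∈ Finset.range N, (A j).indicator (fun _ => F j) θ = F i := by
  obtain ⟨δ, hδ, hp⟩ := Metric.uniformContinuous_iff.1
    (CompactSpace.uniformContinuous_of_continuous p.continuous) ε hε
  let t : ℕ → Icc (-r) 0 := fun i => projIcc (-r) 0 hr (-r + i * (δ / 2))
  have ht : Monotone t := by
    intro i j hij
    refine monotone_projIcc hr ?_
    gcongr
  have ht0 : t 0 = ⟨-r, le_rfl, hr⟩ := by simp [t]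
  have hstep : ∀ i θ, t i < θ → θ ≤ t (i + 1) → dist θ (t (i + 1)) < δ := by
    intro i θ h1 h2
    have h3 : ((t (i + 1) : Icc (-r) 0) : ℝ) ≤ t i + δ / 2 := by
      simp only [t, coe_projIcc]
      push_cast
      have : min 0 (-r + ((i : ℝ) + 1) * (δ / 2)) ≤ min 0 (-r + i * (δ / 2)) + δ / 2 := by
        rw [← min_add_add_right]
        exact min_le_min (by linarith) (by linarith)
      refine max_le ?_ (this.trans (by gcongr; exact le_max_right _ _))
      linarith [le_max_left (-r) (min 0 (-r + i * (δ / 2)))]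
    have h1' : ((t i : Icc (-r) 0) : ℝ) < θ := h1
    have h2' : (θ : ℝ) ≤ t (i + 1) := h2
    rw [Subtype.dist_eq, Real.dist_eq, abs_sub_comm, abs_of_nonneg (by linarith)]
    linarith
  obtain ⟨N, hN⟩ := exists_nat_gt (r / (δ / 2))
  have htN : ∀ θ, θ ≤ t N := by
    intro θ
    have : t N = ⟨0, hr, le_rfl⟩ := by
      refine projIcc_of_right_le hr ?_
      rw [div_lt_iff₀ (by positivity)] at hN
      linarith
    rw [this]
    exact θ.2.2
  -- The index 0 carries the left end point alone, and truncated subtraction makes its left end t 0.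
  -- The index of θ is the first i with θ ≤ t i.
  refine ⟨N + 1, fun i => if i = 0 then Icc (t 0) (t 0) else Ioc (t (i - 1)) (t i),
    fun i => t (i - 1), t, t, fun i => ⟨ht (Nat.sub_le i 1), ?_⟩, fun θ => ?_⟩
  · rcases eq_or_ne i 0 with rfl | hi
    · left; simp
    · right; simp [hi]
  · classical
    have hex : ∃ i, θ ≤ t i := ⟨N, htN θ⟩
    refine ⟨Nat.find hex, ?_, fun F => ?_⟩
    · rcases h : Nat.find hex with _ | i
      · have h1 : θ ≤ t 0 := h ▸ Nat.find_spec hex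
        have h2 : θ = t 0 := le_antisymm h1 (by rw [ht0]; exact θ.2.1)
        rw [h2, dist_self]
        exact hε.le
      · have h1 : θ ≤ t (i + 1) := h ▸ Nat.find_spec hex
        have h2 : t i < θ := not_le.1 (Nat.find_min hex (by omega))
        exact (hp (hstep i θ h2 h1)).le
    · rw [Finset.sum_eq_single (Nat.find hex)]
      · rw [indicator_of_mem]
        have h1 := Nat.find_spec hex
        rcases h : Nat.find hex with _ | i
        · rw [h] at h1
          simpa using le_antisymm h1 (by rw [ht0]; exact θ.2.1)
        · rw [h] at h1
          simpa using ⟨not_le.1 (Nat.find_min hex (by omega)), h1⟩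
      · intro j _ hj
        rw [indicator_of_notMem]
        rcases eq_or_ne j 0 with rfl | hj0
        · simp only [if_true, Icc_self, mem_singleton_iff]
          intro h
          exact hj ((Nat.find_eq_zero hex).2 h.le).symm
        · simp only [hj0, if_false]
          intro h
          have h1 : Nat.find hex ≤ j := Nat.find_min' hex h.2
          have h2 : j - 1 < Nat.find hex := by
            by_contra hlt
            exact (h.1.trans_le (Nat.find_spec hex)).not_ge (ht (not_lt.1 hlt))
          omega
      · intro h
        exact absurd (Finset.mem_range.2 (Nat.lt_succ_of_le (Nat.find_min' hex (htN θ)))) h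

end StepPartition

/-! ### Measures of intervals in terms of jumps and continuous increments -/

section Decomposition

variable {r : ℝ}

theorem rightLim_add_continuous {v c : Icc (-r) 0 → ℝ} (hv : BoundedVariationOn v univ)
    (hc : Continuous c) (x : Icc (-r) 0) :
    (fun θ => v θ + c θ).rightLim x = v.rightLim x + c x := by
  rcases eq_or_neBot (𝓝[>] x) with h | h
  · rw [rightLim_eq_of_eq_bot _ h, rightLim_eq_of_eq_bot _ h]
  · exact rightLim_eq_of_tendsto
      ((hv.tendsto_rightLim x).add (hc.continuousAt.tendsto.mono_left nhdsWithin_le_nhds))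

theorem leftLim_add_continuous {v c : Icc (-r) 0 → ℝ} (hv : BoundedVariationOn v univ)
    (hc : Continuous c) (x : Icc (-r) 0) :
    (fun θ => v θ + c θ).leftLim x = v.leftLim x + c x := by
  rcases eq_or_neBot (𝓝[<] x) with h | h
  · rw [leftLim_eq_of_eq_bot _ h, leftLim_eq_of_eq_bot _ h]
  · exact leftLim_eq_of_tendsto
      ((hv.tendsto_leftLim x).add (hc.continuousAt.tendsto.mono_left nhdsWithin_le_nhds))

/-- Absolute summability permits regrouping the series along the fibres of τ, so coinciding jump
points cause no trouble. -/
theorem IsStepFunction.increment_eq_tsum {v : Icc (-r) 0 → ℝ} (hv : IsStepFunction v)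
    {h : ℕ → ℝ} {τ : ℕ → Icc (-r) 0} (hh : Summable fun k => |h k|)
    (hjump : ∀ θ, jump v θ = ∑' k, ({k | θ = τ k} : Set ℕ).indicator h k)
    {a b : Icc (-r) 0} (hab : a ≤ b) :
    v.rightLim b - v.leftLim a = ∑' k, h k * (Icc a b).indicator 1 (τ k) := by
  classical
  rw [hv.2 a b hab]
  have hsum : Summable fun k => h k * (Icc a b).indicator (1 : Icc (-r) 0 → ℝ) (τ k) := by
    refine Summable.of_norm_bounded hh fun k => ?_
    rw [Real.norm_eq_abs, abs_mul]
    refine mul_le_of_le_one_right (abs_nonneg _) ?_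
    by_cases hk : τ k ∈ Icc a b <;> simp [hk]
  rw [← (hsum.hasSum.tsum_fiberwise τ).tsum_eq]
  refine tsum_congr fun θ => ?_
  rw [tsum_subtype (τ ⁻¹' {θ}) fun k => h k * (Icc a b).indicator (1 : Icc (-r) 0 → ℝ) (τ k)]
  split_ifs with hθ
  · rw [hjump θ]
    refine tsum_congr fun k => ?_
    by_cases hk : θ = τ k
    · subst hk
      simp [hθ]
    · simp [indicator, hk, Ne.symm hk]
  · rw [eq_comm]
    convert tsum_zero with k
    by_cases hk : τ k = θ
    · subst hk
      simp [indicator, hθ]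
    · simp [indicator, hk]

/-- On closed intervals the one-sided limits of c are its values; half-open intervals follow by
removing the left end point. -/
theorem vectorMeasure_interval_eq {v c w : Icc (-r) 0 → ℝ} (hv : IsStepFunction v)
    (hc : Continuous c) (hw : BoundedVariationOn w univ) (hsplit : ∀ θ, w θ = v θ + c θ)
    {h : ℕ → ℝ} {τ : ℕ → Icc (-r) 0} (hh : Summable fun k => |h k|)
    (hjump : ∀ θ, jump v θ = ∑' k, ({k | θ = τ k} : Set ℕ).indicator h k)
    {a b : Icc (-r) 0} (hab : a ≤ b) {s : Set (Icc (-r) 0)} (hs : s = Icc a b ∨ s = Ioc a b) :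
    hw.vectorMeasure s = ∑' k, h k * s.indicator 1 (τ k) + (c b - c a) := by
  have hwf : w = fun θ => v θ + c θ := funext hsplit
  have hsumm : ∀ s : Set (Icc (-r) 0),
      Summable fun k => h k * s.indicator (1 : Icc (-r) 0 → ℝ) (τ k) := by
    intro s
    refine Summable.of_norm_bounded hh fun k => ?_
    rw [Real.norm_eq_abs, abs_mul]
    refine mul_le_of_le_one_right (abs_nonneg _) ?_
    by_cases hk : τ k ∈ s <;> simp [hk]
  have hIcc : ∀ b, a ≤ b → hw.vectorMeasure (Icc a b) =
      ∑' k, h k * (Icc a b).indicator 1 (τ k) + (c b - c a) := by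
    intro b hab
    rw [hw.vectorMeasure_Icc hab, ← hv.increment_eq_tsum hh hjump hab]
    subst hwf
    rw [rightLim_add_continuous hv.1 hc, leftLim_add_continuous hv.1 hc]
    ring
  rcases hs with rfl | rfl
  · exact hIcc b hab
  · have h1 : hw.vectorMeasure (Icc a b) = hw.vectorMeasure (Icc a a) +
        hw.vectorMeasure (Ioc a b) := by
      rw [← VectorMeasure.of_union (by simp) measurableSet_Icc measurableSet_Ioc,
        Icc_union_Ioc_eq_Icc le_rfl hab]
    have h2 : ∑' k, h k * (Icc a b).indicator (1 : Icc (-r) 0 → ℝ) (τ k) =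
        ∑' k, h k * (Icc a a).indicator (1 : Icc (-r) 0 → ℝ) (τ k) +
        ∑' k, h k * (Ioc a b).indicator (1 : Icc (-r) 0 → ℝ) (τ k) := by
      rw [← (hsumm _).tsum_add (hsumm _)]
      refine tsum_congr fun k => ?_
      rw [← mul_add, ← Icc_union_Ioc_eq_Icc le_rfl hab,
        indicator_union_of_disjoint (by simp)]
    rw [hIcc b hab, hIcc a le_rfl, h2] at h1
    linarith

end Decomposition

/-! ### Weak continuity of the Stieltjes measures in the state -/

section WeakContinuity

variable {r : ℝ} {Y : Type*} [TopologicalSpace Y]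

theorem continuous_tsum_abs {h : ℕ → Y → ℝ} (hh : ∀ k, Continuous (h k))
    (hloc : TendstoLocallyUniformly (fun (N : ℕ) φ => ∑ k ∈ Finset.range N, |h k φ|)
      (fun φ => ∑' k, |h k φ|) atTop) : Continuous fun φ => ∑' k, |h k φ| :=
  hloc.continuous (Frequently.of_forall fun N => by fun_prop)

/-- The tails are at most C times those of ∑ |h k|, so locally uniform convergence is inherited. -/
theorem continuous_tsum_mul {h : ℕ → Y → ℝ} (hh : ∀ k, Continuous (h k))
    (hsum : ∀ φ, Summable fun k => |h k φ|)
    (hloc : TendstoLocallyUniformly (fun (N : ℕ) φ => ∑ k ∈ Finset.range N, |h k φ|)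
      (fun φ => ∑' k, |h k φ|) atTop) {q : ℕ → Y → ℝ} (hq : ∀ k, Continuous (q k)) {C : ℝ}
    (hC : 0 ≤ C) (hqC : ∀ k φ, |q k φ| ≤ C) : Continuous fun φ => ∑' k, h k φ * q k φ := by
  have hle : ∀ k φ, |h k φ * q k φ| ≤ |h k φ| * C := fun k φ => by
    rw [abs_mul]
    exact mul_le_mul_of_nonneg_left (hqC k φ) (abs_nonneg _)
  have hs2 : ∀ φ, Summable fun k => |h k φ * q k φ| := fun φ =>
    Summable.of_nonneg_of_le (fun _ => abs_nonneg _) (fun k => hle k φ) ((hsum φ).mul_right C)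
  have hlim : TendstoLocallyUniformly (fun (N : ℕ) φ => ∑ k ∈ Finset.range N, h k φ * q k φ)
      (fun φ => ∑' k, h k φ * q k φ) atTop := by
    rw [Metric.tendstoLocallyUniformly_iff] at hloc ⊢
    intro ε hε φ₀
    obtain ⟨t, ht, hN⟩ := hloc (ε / (C + 1)) (by positivity) φ₀
    refine ⟨t, ht, hN.mono fun N hN φ hφ => ?_⟩
    have h1 := hN φ hφ
    rw [Real.dist_eq] at h1 ⊢
    rw [← (hsum φ).sum_add_tsum_nat_add N, add_sub_cancel_left,
      abs_of_nonneg (tsum_nonneg fun _ => abs_nonneg _)] at h1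
    rw [← (hs2 φ).of_abs.sum_add_tsum_nat_add N, add_sub_cancel_left]
    have hsN := (summable_nat_add_iff (f := fun k => |h k φ|) N).2 (hsum φ)
    calc |∑' i, h (i + N) φ * q (i + N) φ| ≤ ∑' i, |h (i + N) φ * q (i + N) φ| := by
          exact norm_tsum_le_tsum_norm (f := fun i => h (i + N) φ * q (i + N) φ)
            ((summable_nat_add_iff (f := fun k => |h k φ * q k φ|) N).2 (hs2 φ))
      _ ≤ ∑' i, |h (i + N) φ| * C := Summable.tsum_le_tsum (fun i => hle _ φ)
          ((summable_nat_add_iff (f := fun k => |h k φ * q k φ|) N).2 (hs2 φ)) (hsN.mul_right C)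
      _ = (∑' i, |h (i + N) φ|) * C := tsum_mul_right
      _ ≤ (ε / (C + 1)) * C := mul_le_mul_of_nonneg_right h1.le hC
      _ < ε := by
          rw [div_mul_eq_mul_div, div_lt_iff₀ (by positivity)]
          nlinarith
  exact hlim.continuous (Frequently.of_forall fun N =>
    continuous_finsetSum _ fun k _ => (hh k).mul (hq k))

/-- Integrals of a fixed continuous function against the Stieltjes measures of `g(·, φ)` depend
continuously on `φ`. -/
theorem continuous_integral_vectorMeasure (hr : -r ≤ 0) {g v c : Icc (-r) 0 → Y → ℝ}
    (hg : ∀ φ, BoundedVariationOn (fun θ => g θ φ) univ) {V : ℝ≥0}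
    (hgV : ∀ φ, eVariationOn (fun θ => g θ φ) univ ≤ V)
    (hsplit : ∀ θ φ, g θ φ = v θ φ + c θ φ) (hv : ∀ φ, IsStepFunction fun θ => v θ φ)
    (hc : ∀ φ, Continuous fun θ => c θ φ) (hc' : ∀ θ, Continuous (c θ))
    {h : ℕ → Y → ℝ} {τ : ℕ → Y → Icc (-r) 0} (hτ : ∀ k, Continuous (τ k))
    (hh : ∀ k, Continuous (h k)) (hsum : ∀ φ, Summable fun k => |h k φ|)
    (hloc : TendstoLocallyUniformly (fun (N : ℕ) φ => ∑ k ∈ Finset.range N, |h k φ|)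
      (fun φ => ∑' k, |h k φ|) atTop)
    (hjump : ∀ φ θ, jump (fun θ => v θ φ) θ =
      ∑' k, ({k | θ = τ k φ} : Set ℕ).indicator (h · φ) k) (p : C(Icc (-r) 0, ℝ)) :
    Continuous fun φ => ∫ᵛ θ, p θ ∂•(hg φ).vectorMeasure := by
  have hbot : IsBot (⟨-r, le_rfl, hr⟩ : Icc (-r) 0) := fun θ => θ.2.1
  have htop : IsTop (⟨0, hr, le_rfl⟩ : Icc (-r) 0) := fun θ => θ.2.2
  have hvar : ∀ φ, (hg φ).vectorMeasure.variation univ ≤ (2 * V : ℝ≥0) := fun φ => by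
    refine (variation_vectorMeasure_univ_le (hg φ) hbot htop).trans ?_
    push_cast
    gcongr
    exact hgV φ
  have hfin : ∀ φ, IsFiniteMeasure (hg φ).vectorMeasure.variation := fun φ =>
    ⟨(hvar φ).trans_lt ENNReal.coe_lt_top⟩
  have hvar' : ∀ φ, (hg φ).vectorMeasure.variation.real univ ≤ 2 * V := fun φ =>
    ENNReal.toReal_le_of_le_ofReal (by positivity) (by
      rw [ENNReal.ofReal_mul (by norm_num)]
      simpa using hvar φ)
  refine continuous_of_locally_uniform_approx_of_continuousAt fun φ₀ u hu => ?_
  obtain ⟨ε, hε, hεu⟩ := Metric.mem_uniformity_dist.1 hu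
  set S := fun φ => ∑' k, |h k φ|
  have hS : Continuous S := continuous_tsum_abs hh hloc
  have hS0 : ∀ φ, 0 ≤ S φ := fun φ => tsum_nonneg fun _ => abs_nonneg _
  -- Replacing p by the step function costs ε/D times 2V in the integral and ε/D times S φ < S φ₀ +
  -- 1 in the jump series; the last 1 makes the total strictly less than ε.
  set D := 2 * (V : ℝ) + (S φ₀ + 1) + 1
  have hD : 0 < D := by have := hS0 φ₀; positivity
  obtain ⟨N, A, a, b, s, hA, hpart⟩ := exists_step_partition hr p (div_pos hε hD)
  have hAm : ∀ i, MeasurableSet (A i) := fun i => by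
    rcases (hA i).2 with h | h <;> rw [h]
    exacts [measurableSet_Icc, measurableSet_Ioc]
  let ψ : Icc (-r) 0 → ℝ := fun θ => ∑ i ∈ Finset.range N, (A i).indicator (fun _ => p (s i)) θ
  have hψ : ∀ θ, |p θ - ψ θ| ≤ ε / D := by
    intro θ
    obtain ⟨i, hi, hF⟩ := hpart θ
    simp only [ψ, hF fun j => p (s j)]
    exact hi
  have hpb : ∀ θ, |p θ| ≤ ‖p‖ := fun θ => p.norm_coe_le_norm θ
  have hintp : ∀ φ, (hg φ).vectorMeasure.Integrable p := fun φ =>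
    Integrable.of_bound p.continuous.measurable.aestronglyMeasurable ‖p‖ (Eventually.of_forall hpb)
  have hinti : ∀ φ i, (hg φ).vectorMeasure.Integrable ((A i).indicator fun _ => p (s i)) :=
    fun φ i => (integrable_const _).indicator (hAm i)
  have hintψ : ∀ φ, (hg φ).vectorMeasure.Integrable ψ := fun φ =>
    integrable_finsetSum _ fun i _ => hinti φ i
  have hψint : ∀ φ, ∫ᵛ θ, ψ θ ∂•(hg φ).vectorMeasure =
      ∑' k, h k φ * ψ (τ k φ) + ∑ i ∈ Finset.range N, p (s i) * (c (b i) φ - c (a i) φ) := by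
    intro φ
    have h1 : ∫ᵛ θ, ψ θ ∂•(hg φ).vectorMeasure =
        ∑ i ∈ Finset.range N, p (s i) * (hg φ).vectorMeasure (A i) := by
      simp only [ψ]
      rw [VectorMeasure.integral_finsetSum _ fun i _ => hinti φ i]
      refine Finset.sum_congr rfl fun i _ => ?_
      rw [VectorMeasure.integral_indicator_const _ (hAm i)]
      simp
    have h2 : ∀ i, Summable fun k => h k φ * (A i).indicator (1 : Icc (-r) 0 → ℝ) (τ k φ) := by
      intro i
      refine Summable.of_norm_bounded (hsum φ) fun k => ?_
      rw [Real.norm_eq_abs, abs_mul]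
      refine mul_le_of_le_one_right (abs_nonneg _) ?_
      by_cases hk : τ k φ ∈ A i <;> simp [hk]
    have h3 : ∑' k, h k φ * ψ (τ k φ) = ∑ i ∈ Finset.range N, p (s i) *
        ∑' k, h k φ * (A i).indicator (1 : Icc (-r) 0 → ℝ) (τ k φ) := by
      simp_rw [← tsum_mul_left]
      rw [← Summable.tsum_finsetSum fun i _ => (h2 i).mul_left _]
      refine tsum_congr fun k => ?_
      simp only [ψ, Finset.mul_sum]
      refine Finset.sum_congr rfl fun i _ => ?_
      by_cases hk : τ k φ ∈ A i
      · simp [hk, mul_comm]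
      · simp [hk]
    rw [h1, h3, ← Finset.sum_add_distrib]
    refine Finset.sum_congr rfl fun i _ => ?_
    rw [vectorMeasure_interval_eq (hv φ) (hc φ) (hg φ) (fun θ => hsplit θ φ) (hsum φ) (hjump φ)
      (hA i).1 (hA i).2, mul_add]
  -- The jump series keeps p itself: ψ(τ k φ) may be discontinuous in φ when a jump point crosses
  -- the partition. Only the continuous parts use the step values.
  refine ⟨{φ | S φ < S φ₀ + 1}, hS.continuousAt.eventually_lt continuousAt_const (by simp),
    fun φ => ∑' k, h k φ * p (τ k φ) +
      ∑ i ∈ Finset.range N, p (s i) * (c (b i) φ - c (a i) φ), Continuous.continuousAt ?_,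
    fun φ hφ => hεu ?_⟩
  · refine (continuous_tsum_mul hh hsum hloc (fun k => p.continuous.comp (hτ k)) (norm_nonneg p)
      fun k φ => hpb _).add ?_
    exact continuous_finsetSum _ fun i _ => continuous_const.mul ((hc' _).sub (hc' _))
  · have hε0 : 0 ≤ ε / D := by positivity
    have e1 : |∫ᵛ θ, (p θ - ψ θ) ∂•(hg φ).vectorMeasure| ≤ ε / D * (2 * V) :=
      (abs_integral_vectorMeasure_le hε0 hψ).trans (mul_le_mul_of_nonneg_left (hvar' φ) hε0)
    rw [VectorMeasure.integral_fun_sub (hintp φ) (hintψ φ), hψint φ] at e1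
    have hs0 : ∀ q : Icc (-r) 0 → ℝ, ∀ C, (∀ θ, |q θ| ≤ C) →
        Summable (fun k => |h k φ * q (τ k φ)|) ∧
          |∑' k, h k φ * q (τ k φ)| ≤ C * S φ := by
      intro q C hq
      have hle : ∀ k, |h k φ * q (τ k φ)| ≤ C * |h k φ| := fun k => by
        rw [abs_mul, mul_comm]
        exact mul_le_mul_of_nonneg_right (hq _) (abs_nonneg _)
      have hs : Summable (fun k => |h k φ * q (τ k φ)|) :=
        Summable.of_nonneg_of_le (fun _ => abs_nonneg _) hle ((hsum φ).mul_left C)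
      refine ⟨hs, ?_⟩
      calc |∑' k, h k φ * q (τ k φ)| ≤ ∑' k, |h k φ * q (τ k φ)| := by
            exact norm_tsum_le_tsum_norm (f := fun k => h k φ * q (τ k φ)) hs
        _ ≤ ∑' k, C * |h k φ| := hs.tsum_le_tsum hle ((hsum φ).mul_left C)
        _ = C * S φ := tsum_mul_left
    have e2 := (hs0 (fun θ => p θ - ψ θ) _ hψ).2
    have hψb : ∀ θ, |ψ θ| ≤ ‖p‖ := by
      intro θ
      obtain ⟨i, -, hF⟩ := hpart θ
      simp only [ψ, hF fun j => p (s j)]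
      exact hpb _
    have e3 : ∑' k, h k φ * (p (τ k φ) - ψ (τ k φ)) =
        ∑' k, h k φ * p (τ k φ) - ∑' k, h k φ * ψ (τ k φ) := by
      rw [← (hs0 p _ hpb).1.of_abs.tsum_sub (hs0 ψ _ hψb).1.of_abs]
      exact tsum_congr fun k => mul_sub _ _ _
    rw [e3] at e2
    have hφ' : S φ ≤ S φ₀ + 1 := le_of_lt hφ
    have e4 : ε / D * S φ ≤ ε / D * (S φ₀ + 1) := mul_le_mul_of_nonneg_left hφ' hε0
    have e5 : ε / D * (2 * V) + ε / D * (S φ₀ + 1) < ε := by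
      rw [← mul_add, div_mul_eq_mul_div, div_lt_iff₀ hD]
      exact mul_lt_mul_of_pos_left (by simp only [D]; linarith) hε
    rw [Real.dist_eq]
    rw [abs_le] at e1 e2
    rw [abs_lt]
    constructor <;> linarith

end WeakContinuity

/-! ### L² estimates on finite measure spaces -/

section LpGeneral

variable {α : Type*} [MeasurableSpace α] {μ : Measure α}

theorem exists_integral_norm_le_Lp_two (μ : Measure α) [IsFiniteMeasure μ] :
    ∃ κ : ℝ, 0 ≤ κ ∧ ∀ v : Lp ℝ 2 μ, ∫ y, |v y| ∂μ ≤ κ * ‖v‖ := by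
  refine ⟨(μ univ ^ (1 / (1 : ℝ≥0∞).toReal - 1 / (2 : ℝ≥0∞).toReal)).toReal,
    ENNReal.toReal_nonneg, fun v => ?_⟩
  have h := eLpNorm_le_eLpNorm_mul_rpow_measure_univ (μ := μ) (p := 1) (q := 2)
    (by norm_num) (Lp.aestronglyMeasurable v)
  have hfin : μ univ ^ (1 / (1 : ℝ≥0∞).toReal - 1 / (2 : ℝ≥0∞).toReal) ≠ ∞ :=
    ENNReal.rpow_ne_top_of_nonneg (by norm_num) (measure_ne_top _ _)
  have h1 : ∫ y, |v y| ∂μ = (eLpNorm v 1 μ).toReal := by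
    rw [eLpNorm_one_eq_lintegral_enorm]
    exact integral_norm_eq_lintegral_enorm (Lp.aestronglyMeasurable v)
  rw [h1, Lp.norm_def, mul_comm, ← ENNReal.toReal_mul]
  exact ENNReal.toReal_mono (ENNReal.mul_ne_top (Lp.eLpNorm_ne_top v) hfin) h

theorem norm_toLp_two_sq {F : α → ℝ} (hF : MemLp F 2 μ) :
    ‖hF.toLp‖ ^ 2 = ∫ x, F x ^ 2 ∂μ := by
  rw [← real_inner_self_eq_norm_sq, L2.inner_def]
  refine integral_congr_ae ?_
  filter_upwards [hF.coeFn_toLp] with x hx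
  rw [hx]
  simp [sq]

/-- On a finite measure space the `L²` norm is controlled by an almost everywhere bound. -/
theorem norm_toLp_two_le [IsFiniteMeasure μ] {F : α → ℝ} (hF : MemLp F 2 μ) {C : ℝ} (hC : 0 ≤ C)
    (h : ∀ᵐ x ∂μ, |F x| ≤ C) : ‖hF.toLp‖ ≤ √(μ.real univ) * C := by
  refine (sq_le_sq₀ (norm_nonneg _) (by positivity)).1 ?_
  rw [norm_toLp_two_sq, mul_pow, Real.sq_sqrt measureReal_nonneg]
  calc ∫ x, F x ^ 2 ∂μ ≤ ∫ _, C ^ 2 ∂μ := by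
        refine integral_mono_ae hF.integrable_sq (integrable_const _) ?_
        filter_upwards [h] with x hx
        exact sq_le_sq' (neg_le_of_abs_le hx) (le_of_abs_le hx)
    _ = μ.real univ * C ^ 2 := by simp

/-- Dominated convergence in `L²`, for families depending on a parameter. -/
theorem continuous_toLp_two [IsFiniteMeasure μ] {Y : Type*} [TopologicalSpace Y] [FirstCountableTopology Y]
    {J : Y → α → ℝ} (hJ : ∀ φ, MemLp (J φ) 2 μ) (hc : ∀ᵐ x ∂μ, Continuous fun φ => J φ x)
    {B : Y → ℝ} (hB : Continuous B) (hbd : ∀ᵐ x ∂μ, ∀ φ, |J φ x| ≤ B φ) :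
    Continuous fun φ => (hJ φ).toLp := by
  refine continuous_iff_continuousAt.2 fun φ₀ => ?_
  rw [ContinuousAt, tendsto_iff_norm_sub_tendsto_zero]
  have hint : Tendsto (fun φ => ∫ x, (J φ x - J φ₀ x) ^ 2 ∂μ) (𝓝 φ₀) (𝓝 (∫ _, (0 : ℝ) ∂μ)) := by
    refine tendsto_integral_filter_of_dominated_convergence
      (fun _ => (2 * (B φ₀ + 1)) ^ 2) (Eventually.of_forall fun φ =>
        (((hJ φ).1.sub (hJ φ₀).1).pow 2)) ?_ (integrable_const _) ?_
    · have hev : ∀ᶠ φ in 𝓝 φ₀, B φ < B φ₀ + 1 :=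
        hB.continuousAt.eventually_lt continuousAt_const (by simp)
      filter_upwards [hev] with φ hφ
      filter_upwards [hbd] with x hx
      rw [Real.norm_of_nonneg (sq_nonneg _), ← sq_abs]
      refine pow_le_pow_left₀ (abs_nonneg _) ?_ 2
      have := abs_sub (J φ x) (J φ₀ x)
      linarith [hx φ, hx φ₀]
    · filter_upwards [hc] with x hx
      have hsq : Continuous fun φ => (J φ x - J φ₀ x) ^ 2 := (hx.sub continuous_const).pow 2
      have := hsq.tendsto φ₀
      rwa [sub_self, zero_pow two_ne_zero] at this
  rw [integral_zero] at hint
  have h2 := (Real.continuous_sqrt.tendsto 0).comp hint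
  rw [Real.sqrt_zero] at h2
  refine h2.congr fun φ => ?_
  have hs := norm_toLp_two_sq ((hJ φ).sub (hJ φ₀))
  rw [← MemLp.toLp_sub]
  simp only [Function.comp_apply]
  rw [Real.sqrt_eq_iff_mul_self_eq (integral_nonneg fun _ => sq_nonneg _) (norm_nonneg _), ← sq, hs]
  rfl

end LpGeneral

/-! ### The spatial integral operator -/

section Response

open scoped Pointwise

variable {n : ℕ} {Ω : Set (EuclideanSpace ℝ (Fin n))}

/-- The spatial response `x ↦ ∫_Ω b(v(y)) f(x-y) dy`. -/
def response (b : ℝ → ℝ) (f : EuclideanSpace ℝ (Fin n) → ℝ) (v : L2 Ω)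
    (x : EuclideanSpace ℝ (Fin n)) : ℝ :=
  ∫ y in Ω, b (v y) * f (x - y)

/-- Nothing is known of f outside Ω - Ω; extension by zero makes it measurable on the whole space,
so that reflections and translations can be applied. -/
theorem aemeasurable_indicator_of_sub (hΩ : IsOpen Ω) {f : EuclideanSpace ℝ (Fin n) → ℝ}
    (hf : AEMeasurable f (volume.restrict (Ω - Ω))) :
    AEMeasurable ((Ω - Ω).indicator f) volume :=
  (aemeasurable_indicator_iff hΩ.sub_left.measurableSet).2 hf

theorem aestronglyMeasurable_kernel (hΩ : IsOpen Ω) {f : EuclideanSpace ℝ (Fin n) → ℝ}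
    (hf : AEMeasurable f (volume.restrict (Ω - Ω))) {x : EuclideanSpace ℝ (Fin n)} (hx : x ∈ Ω) :
    AEStronglyMeasurable (fun y => f (x - y)) (volume.restrict Ω) := by
  have h := ((aemeasurable_indicator_of_sub hΩ hf).comp_quasiMeasurePreserving
    (Measure.measurePreserving_sub_left volume x).quasiMeasurePreserving).mono_measure
      (Measure.restrict_le_self (s := Ω))
  refine (h.congr ?_).aestronglyMeasurable
  filter_upwards [ae_restrict_mem hΩ.measurableSet] with y hy
  exact indicator_of_mem (sub_mem_sub hx hy) f

theorem integrable_comp_of_growth [IsFiniteMeasure (volume.restrict Ω)] {b : ℝ → ℝ} {C₁ C₂ : ℝ}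
    (hb : Continuous b) (hgrowth : ∀ s, |b s| ≤ C₁ * |s| + C₂) (v : L2 Ω) :
    Integrable (fun y => b (v y)) (volume.restrict Ω) := by
  have hv : Integrable v (volume.restrict Ω) := (Lp.memLp v).integrable one_le_two
  exact ((hv.abs.const_mul C₁).add (integrable_const C₂)).mono'
    (hb.comp_aestronglyMeasurable hv.1) (Eventually.of_forall fun y => hgrowth _)

theorem aestronglyMeasurable_response (hΩ : IsOpen Ω) [IsFiniteMeasure (volume.restrict Ω)]
    {f : EuclideanSpace ℝ (Fin n) → ℝ} (hf : AEMeasurable f (volume.restrict (Ω - Ω)))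
    {b : ℝ → ℝ} (hb : Continuous b) (v : L2 Ω) :
    AEStronglyMeasurable (response b f v) (volume.restrict Ω) := by
  have h1 : AEStronglyMeasurable
      (fun p : EuclideanSpace ℝ (Fin n) × EuclideanSpace ℝ (Fin n) =>
        b (v p.2) * (Ω - Ω).indicator f (p.1 - p.2))
      ((volume.restrict Ω).prod (volume.restrict Ω)) := by
    refine AEStronglyMeasurable.mul ?_ ?_
    · exact (hb.comp_aestronglyMeasurable (Lp.aestronglyMeasurable v)).comp_snd
    · have hq := quasiMeasurePreserving_sub_of_right_invariant
        (volume : Measure (EuclideanSpace ℝ (Fin n))) (volume.restrict Ω)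
      have h2 := ((aemeasurable_indicator_of_sub hΩ hf).comp_quasiMeasurePreserving hq)
      exact (h2.mono_ac
        (Measure.absolutelyContinuous_of_le Measure.restrict_le_self |>.prod
          Measure.AbsolutelyContinuous.rfl)).aestronglyMeasurable
  refine h1.integral_prod_right'.congr ?_
  filter_upwards [ae_restrict_mem hΩ.measurableSet] with x hx
  refine setIntegral_congr_fun hΩ.measurableSet fun y hy => ?_
  simp only [indicator_of_mem (sub_mem_sub hx hy) f]

/-- The kernel is bounded by |M|, which leaves an L¹ norm of the argument, controlled by its L² norm
on finite measure. All constants are uniform in x ∈ Ω. -/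
theorem exists_response_bounds (hΩ : IsOpen Ω) [IsFiniteMeasure (volume.restrict Ω)]
    {f : EuclideanSpace ℝ (Fin n) → ℝ} (hf : AEMeasurable f (volume.restrict (Ω - Ω)))
    {M : ℝ} (hfM : ∀ z ∈ Ω - Ω, |f z| ≤ M) {b : ℝ → ℝ} {L : ℝ≥0} (hb : LipschitzWith L b)
    {C₁ C₂ : ℝ} (hC₁ : 0 ≤ C₁) (hC₂ : 0 ≤ C₂) (hgrowth : ∀ s, |b s| ≤ C₁ * |s| + C₂) :
    ∃ (K : ℝ≥0) (B₁ B₂ : ℝ), 0 ≤ B₁ ∧ 0 ≤ B₂ ∧ ∀ x ∈ Ω,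
      (LipschitzWith K fun v : L2 Ω => response b f v x) ∧
      ∀ v : L2 Ω, |response b f v x| ≤ B₁ * ‖v‖ + B₂ := by
  obtain ⟨κ, hκ, hκv⟩ := exists_integral_norm_le_Lp_two (volume.restrict Ω)
  set m := (volume.restrict Ω).real univ
  have hint : ∀ v : L2 Ω, Integrable v (volume.restrict Ω) :=
    fun v => (Lp.memLp v).integrable one_le_two
  refine ⟨(|M| * (L * κ)).toNNReal, |M| * (C₁ * κ), |M| * (C₂ * m), by positivity,
    by positivity, fun x hx => ?_⟩
  have hfx : ∀ᵐ y ∂(volume.restrict Ω), |f (x - y)| ≤ |M| := by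
    filter_upwards [ae_restrict_mem hΩ.measurableSet] with y hy
    exact (hfM _ (sub_mem_sub hx hy)).trans (le_abs_self M)
  have hbi : ∀ v : L2 Ω, Integrable (fun y => b (v y)) (volume.restrict Ω) :=
    integrable_comp_of_growth hb.continuous hgrowth
  have hprod : ∀ v : L2 Ω, Integrable (fun y => b (v y) * f (x - y)) (volume.restrict Ω) :=
    fun v => (hbi v).mul_bdd (aestronglyMeasurable_kernel hΩ hf hx) hfx
  have hbound : ∀ (q w : EuclideanSpace ℝ (Fin n) → ℝ), Integrable w (volume.restrict Ω) →
      (∀ᵐ y ∂(volume.restrict Ω), |q y| ≤ w y) →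
      |∫ y in Ω, q y * f (x - y)| ≤ |M| * ∫ y in Ω, w y := by
    intro q w hw hqw
    rw [← integral_const_mul, ← Real.norm_eq_abs]
    refine norm_integral_le_of_norm_le (hw.const_mul _) ?_
    filter_upwards [hqw, hfx] with y h1 h2
    rw [Real.norm_eq_abs, abs_mul, mul_comm]
    exact mul_le_mul h2 h1 (abs_nonneg _) (abs_nonneg _)
  constructor
  · refine LipschitzWith.of_dist_le_mul fun v w => ?_
    rw [Real.coe_toNNReal _ (by positivity), Real.dist_eq, response, response,
      ← integral_sub (hprod v) (hprod w)]
    have h1 := hbound (fun y => b (v y) - b (w y)) (fun y => L * |(v - w : L2 Ω) y|)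
      ((hint (v - w)).abs.const_mul _) (by
        filter_upwards [Lp.coeFn_sub v w] with y hy
        rw [hy]
        exact hb.dist_le_mul (v y) (w y))
    simp only [sub_mul] at h1
    refine h1.trans ?_
    rw [integral_const_mul, dist_eq_norm, mul_assoc, mul_assoc]
    gcongr
    exact hκv (v - w)
  · intro v
    have h1 := hbound (fun y => b (v y)) (fun y => C₁ * |v y| + C₂)
      (((hint v).abs.const_mul C₁).add (integrable_const C₂))
      (Eventually.of_forall fun y => hgrowth _)
    refine h1.trans ?_
    rw [integral_add ((hint v).abs.const_mul C₁) (integrable_const C₂), integral_const_mul,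
      integral_const, smul_eq_mul, mul_assoc, mul_assoc, ← mul_add]
    refine mul_le_mul_of_nonneg_left ?_ (abs_nonneg _)
    have := mul_le_mul_of_nonneg_left (hκv v) hC₁
    rw [mul_comm C₂]
    simp only [m] at *
    linarith

end Response

/-! ### Parameter dependence of Stieltjes integrals -/

section StieltjesIntegral

variable {r : ℝ} {α H Y : Type*} [NormedAddCommGroup H]

theorem isFiniteMeasure_variation_vectorMeasure (hr : -r ≤ 0) {v : Icc (-r) 0 → ℝ}
    (hv : BoundedVariationOn v univ) : IsFiniteMeasure hv.vectorMeasure.variation :=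
  ⟨(variation_vectorMeasure_univ_le hv (b := ⟨-r, le_rfl, hr⟩) (t := ⟨0, hr, le_rfl⟩)
    (fun θ => θ.2.1) (fun θ => θ.2.2)).trans_lt (ENNReal.mul_lt_top (by norm_num) hv.lt_top)⟩

theorem variation_real_vectorMeasure_le (hr : -r ≤ 0) {v : Icc (-r) 0 → ℝ}
    (hv : BoundedVariationOn v univ) {V : ℝ≥0} (hV : eVariationOn v univ ≤ V) :
    hv.vectorMeasure.variation.real univ ≤ 2 * V :=
  ENNReal.toReal_le_of_le_ofReal (by positivity) (by
    rw [ENNReal.ofReal_mul (by norm_num)]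
    refine (variation_vectorMeasure_univ_le hv (b := ⟨-r, le_rfl, hr⟩) (t := ⟨0, hr, le_rfl⟩)
      (fun θ => θ.2.1) (fun θ => θ.2.2)).trans ?_
    simpa using mul_le_mul_right hV 2)

theorem integrable_vectorMeasure_of_continuous (hr : -r ≤ 0) {v : Icc (-r) 0 → ℝ}
    (hv : BoundedVariationOn v univ) (p : C(Icc (-r) 0, ℝ)) : hv.vectorMeasure.Integrable p := by
  have := isFiniteMeasure_variation_vectorMeasure hr hv
  exact Integrable.of_bound p.continuous.measurable.aestronglyMeasurable ‖p‖
    (Eventually.of_forall fun θ => p.norm_coe_le_norm θ)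

/-- Measurable dependence of a Stieltjes integral on a parameter. -/
theorem aestronglyMeasurable_integral_vectorMeasure [MeasurableSpace α] {μ : Measure α}
    (hr : -r ≤ 0) {v : Icc (-r) 0 → ℝ} (hv : BoundedVariationOn v univ) {k : H → α → ℝ}
    {K : ℝ≥0} (hk : ∀ᵐ x ∂μ, LipschitzWith K fun z => k z x)
    (hkm : ∀ z, AEStronglyMeasurable (k z) μ) (φ : C(Icc (-r) 0, H)) :
    AEStronglyMeasurable (fun x => ∫ᵛ θ, k (φ θ) x ∂•hv.vectorMeasure) μ := by
  have hfin := isFiniteMeasure_variation_vectorMeasure hr hv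
  choose N A a b s hA hpart using fun j : ℕ =>
    exists_step_partition hr φ (Nat.one_div_pos_of_nat (α := ℝ) (n := j))
  have hAm : ∀ j i, MeasurableSet (A j i) := fun j i => by
    rcases (hA j i).2 with h | h <;> rw [h]
    exacts [measurableSet_Icc, measurableSet_Ioc]
  -- Riemann-Stieltjes sums along a partition adapted to φ rather than to x: the Lipschitz bound,
  -- uniform in x, lets one partition serve almost every x.
  refine aestronglyMeasurable_of_tendsto_ae atTop
    (f := fun j x => ∑ i ∈ Finset.range (N j), k (φ (s j i)) x * hv.vectorMeasure (A j i))
    (fun j => Finset.aestronglyMeasurable_fun_sum _ fun i _ => (hkm _).mul_const _) ?_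
  filter_upwards [hk] with x hx
  have hp : ∀ j, |(∑ i ∈ Finset.range (N j), k (φ (s j i)) x * hv.vectorMeasure (A j i)) -
      ∫ᵛ θ, k (φ θ) x ∂•hv.vectorMeasure| ≤
        K * (1 / ((j : ℝ) + 1)) * hv.vectorMeasure.variation.real univ := by
    intro j
    have hinti : ∀ i, hv.vectorMeasure.Integrable
        ((A j i).indicator fun _ => k (φ (s j i)) x) := fun i =>
      (integrable_const _).indicator (hAm j i)
    have h1 : ∫ᵛ θ, (∑ i ∈ Finset.range (N j),
        (A j i).indicator (fun _ => k (φ (s j i)) x) θ) ∂•hv.vectorMeasure =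
        ∑ i ∈ Finset.range (N j), k (φ (s j i)) x * hv.vectorMeasure (A j i) := by
      rw [VectorMeasure.integral_finsetSum _ fun i _ => hinti i]
      refine Finset.sum_congr rfl fun i _ => ?_
      rw [VectorMeasure.integral_indicator_const _ (hAm j i)]
      simp
    have hintk : hv.vectorMeasure.Integrable fun θ => k (φ θ) x :=
      integrable_vectorMeasure_of_continuous hr hv
        ⟨fun θ => k (φ θ) x, hx.continuous.comp φ.continuous⟩
    rw [← h1, ← VectorMeasure.integral_fun_sub (integrable_finsetSum _ fun i _ => hinti i) hintk]
    refine abs_integral_vectorMeasure_le (by positivity) fun θ => ?_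
    obtain ⟨i, hi, hF⟩ := hpart j θ
    rw [hF fun i => k (φ (s j i)) x, ← Real.dist_eq, dist_comm]
    exact (hx.dist_le_mul _ _).trans (mul_le_mul_of_nonneg_left hi K.2)
  rw [tendsto_iff_norm_sub_tendsto_zero]
  refine squeeze_zero (fun _ => norm_nonneg _) hp ?_
  have := ((tendsto_one_div_add_atTop_nhds_zero_nat (𝕜 := ℝ)).const_mul (K : ℝ)).mul_const
    (hv.vectorMeasure.variation.real univ)
  simpa using this

/-- Joint continuity of the Stieltjes integral in the integrand and the measure. -/
theorem continuous_integral_vectorMeasure_uncurry [TopologicalSpace Y] (hr : -r ≤ 0)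
    {g : Icc (-r) 0 → Y → ℝ} (hg : ∀ φ, BoundedVariationOn (fun θ => g θ φ) univ) {V : ℝ≥0}
    (hgV : ∀ φ, eVariationOn (fun θ => g θ φ) univ ≤ V)
    (hcont : ∀ p : C(Icc (-r) 0, ℝ), Continuous fun φ => ∫ᵛ θ, p θ ∂•(hg φ).vectorMeasure) :
    Continuous fun z : C(Icc (-r) 0, ℝ) × Y => ∫ᵛ θ, z.1 θ ∂•(hg z.2).vectorMeasure := by
  refine continuous_prod_of_continuous_lipschitzWith _ (2 * V) hcont fun φ => ?_
  have hfin := isFiniteMeasure_variation_vectorMeasure hr (hg φ)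
  refine LipschitzWith.of_dist_le_mul fun p q => ?_
  rw [Real.dist_eq, ← VectorMeasure.integral_fun_sub
    (integrable_vectorMeasure_of_continuous hr (hg φ) p)
    (integrable_vectorMeasure_of_continuous hr (hg φ) q)]
  have h := abs_integral_vectorMeasure_le (μ := (hg φ).vectorMeasure)
    (p := fun θ => p θ - q θ) dist_nonneg fun θ => ContinuousMap.dist_apply_le_dist (f := p) (g := q) θ
  refine h.trans ?_
  rw [mul_comm]
  refine mul_le_mul_of_nonneg_right ?_ dist_nonneg
  simpa using variation_real_vectorMeasure_le hr (hg φ) (hgV φ)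

end StieltjesIntegral

theorem IsAbsCont.continuous {r : ℝ} (hr : -r ≤ 0) {v : Icc (-r) 0 → ℝ} (hv : IsAbsCont v) :
    Continuous v := by
  have h := AbsolutelyContinuousOnInterval.continuousOn hv
  rw [uIcc_of_le hr, continuousOn_iff_continuous_domRestrict] at h
  convert h using 1
  funext θ
  exact (Subtype.val_injective.extend_apply v 0 θ).symm

/-! ### Continuity and growth of the delay term -/

section DelayMap

variable {n : ℕ} {Ω : Set (EuclideanSpace ℝ (Fin n))} {r : ℝ} {b : ℝ → ℝ}
  {f : EuclideanSpace ℝ (Fin n) → ℝ} {g : Icc (-r) 0 → Phase Ω r → ℝ}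
  {hg : ∀ φ, BoundedVariationOn (fun θ => g θ φ) univ}

/-- The delay term is an everywhere defined, continuous map of linear growth. -/
theorem delayMap_spec [IsFiniteMeasure (volume.restrict Ω)] (hΩ : MeasurableSet Ω) (hr : -r ≤ 0)
    {V : ℝ≥0} (hgV : ∀ φ, eVariationOn (fun θ => g θ φ) univ ≤ V)
    (hcont : ∀ p : C(Icc (-r) 0, ℝ), Continuous fun φ => ∫ᵛ θ, p θ ∂•(hg φ).vectorMeasure)
    {K : ℝ≥0} {B₁ B₂ : ℝ} (hB₁ : 0 ≤ B₁) (hB₂ : 0 ≤ B₂)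
    (hlip : ∀ x ∈ Ω, LipschitzWith K fun v : L2 Ω => response b f v x)
    (hbd : ∀ x ∈ Ω, ∀ v : L2 Ω, |response b f v x| ≤ B₁ * ‖v‖ + B₂)
    (hmeas : ∀ v : L2 Ω, AEStronglyMeasurable (response b f v) (volume.restrict Ω)) :
    (∀ φ, MemLp (delayFun b f g hg φ) 2 (volume.restrict Ω)) ∧
      Continuous (delayMap b f g hg) ∧
      ∃ a₁ a₂ : ℝ, 0 ≤ a₁ ∧ 0 ≤ a₂ ∧ ∀ φ, ‖delayMap b f g hg φ‖ ≤ a₁ + a₂ * ‖φ‖ := by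
  have hbound : ∀ x ∈ Ω, ∀ φ : Phase Ω r,
      |delayFun b f g hg φ x| ≤ (B₁ * ‖φ‖ + B₂) * (2 * V) := by
    intro x hx φ
    have := isFiniteMeasure_variation_vectorMeasure hr (hg φ)
    have h0 : 0 ≤ B₁ * ‖φ‖ + B₂ := by positivity
    refine (abs_integral_vectorMeasure_le (p := fun θ => response b f (φ θ) x) h0 fun θ => ?_).trans
      (mul_le_mul_of_nonneg_left (variation_real_vectorMeasure_le hr (hg φ) (hgV φ)) h0)
    refine (hbd x hx (φ θ)).trans ?_
    gcongr
    exact φ.norm_coe_le_norm θ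
  have hae : ∀ᵐ x ∂(volume.restrict Ω), x ∈ Ω := ae_restrict_mem hΩ
  have hm : ∀ φ, MemLp (delayFun b f g hg φ) 2 (volume.restrict Ω) := fun φ =>
    MemLp.of_bound (aestronglyMeasurable_integral_vectorMeasure hr (hg φ)
      (k := response b f) (hae.mono hlip) hmeas φ) _ (hae.mono fun x hx => hbound x hx φ)
  have hF : delayMap b f g hg = fun φ => (hm φ).toLp := by
    funext φ
    simp only [delayMap, dif_pos (hm φ)]
  refine ⟨hm, ?_, ?_⟩
  · rw [hF]
    refine continuous_toLp_two hm (B := fun φ => (B₁ * ‖φ‖ + B₂) * (2 * V)) ?_ (by fun_prop)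
      (hae.mono hbound)
    filter_upwards [hae] with x hx
    -- The state enters both the integrand and the measure, so joint continuity is composed with
    -- this map.
    have hpost : Continuous fun φ : Phase Ω r =>
        ((⟨fun v => response b f v x, (hlip x hx).continuous⟩ : C(L2 Ω, ℝ)).comp φ, φ) :=
      (ContinuousMap.continuous_postcomp _).prodMk continuous_id
    have h := (continuous_integral_vectorMeasure_uncurry hr hg hgV hcont).comp hpost
    unfold delayFun
    exact h
  · refine ⟨√((volume.restrict Ω).real univ) * (B₂ * (2 * V)),
      √((volume.restrict Ω).real univ) * (B₁ * (2 * V)), by positivity, by positivity, fun φ => ?_⟩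
    rw [hF]
    refine (norm_toLp_two_le (hm φ) (C := (B₁ * ‖φ‖ + B₂) * (2 * V)) (by positivity)
      (hae.mono fun x hx => hbound x hx φ)).trans (le_of_eq (by ring))

end DelayMap

end StieltjesDelay

end


/-! ### The main theorem -/

open StieltjesDelay in
open scoped Pointwise in
theorem theorem1 {n : ℕ} {Ω : Set (EuclideanSpace ℝ (Fin n))}
    -- a bounded domain
    (hΩ_open : IsOpen Ω) (hΩ_bdd : Bornology.IsBounded Ω)
    -- a densely defined positive self-adjoint operator with compact resolvent, and `d ≥ 0`
    {A : L2 Ω →ₗ.[ℝ] L2 Ω} (hA_dense : Dense (A.domain : Set (L2 Ω)))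
    (hA_selfAdjoint : IsSelfAdjoint A) (hA_pos : ∀ x : A.domain, 0 ≤ inner ℝ (A x) (x : L2 Ω))
    (hA_res : HasCompactResolvent A) {d : ℝ} (hd : 0 ≤ d)
    -- `f` is bounded and measurable on `Ω - Ω`
    {f : EuclideanSpace ℝ (Fin n) → ℝ} (hf_meas : AEMeasurable f (volume.restrict (Ω - Ω)))
    {M_f : ℝ} (hf_bdd : ∀ z ∈ Ω - Ω, |f z| ≤ M_f)
    -- `b` is Lipschitz with linear growth
    {b : ℝ → ℝ} {L_b C₁ C₂ : ℝ} (hb_lip : ∀ s t : ℝ, |b s - b t| ≤ L_b * |s - t|)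
    (hC₁ : 0 ≤ C₁) (hC₂ : 0 ≤ C₂) (hb_growth : ∀ s : ℝ, |b s| ≤ C₁ * |s| + C₂)
    -- `g` has bounded variation in the first variable, uniformly in the second
    {r : ℝ} (hr : 0 < r) {g : Icc (-r) 0 → Phase Ω r → ℝ}
    (hg : ∀ φ, BoundedVariationOn (fun θ => g θ φ) univ)
    {M_Vg : ℝ} (hg_unif : ∀ φ, eVariationOn (fun θ => g θ φ) univ ≤ ENNReal.ofReal M_Vg)
    -- the splitting of `g` into a step function, an absolutely continuous and a singular part
    {g_d g_ac g_s : Icc (-r) 0 → Phase Ω r → ℝ}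
    (hg_split : ∀ θ φ, g θ φ = g_d θ φ + g_ac θ φ + g_s θ φ)
    (hg_d : ∀ φ, IsStepFunction (fun θ => g_d θ φ))
    (hg_ac : ∀ φ, IsAbsCont (fun θ => g_ac θ φ))
    (hg_s : ∀ φ, IsSingularCont (fun θ => g_s θ φ))
    -- the continuous parts are continuous in the second variable
    (hg_ac_cont : ∀ θ, Continuous (fun φ => g_ac θ φ))
    (hg_s_cont : ∀ θ, Continuous (fun φ => g_s θ φ))
    -- the jumps of `g_d(·, φ)` are `h k φ` at the points `-η k φ`; where several of these
    -- points coincide, the `h k φ` add up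
    {η h : ℕ → Phase Ω r → ℝ}
    (hη_mem : ∀ k φ, η k φ ∈ Icc 0 r) (hη_cont : ∀ k, Continuous (η k))
    (hh_cont : ∀ k, Continuous (h k))
    (hh_summable : ∀ φ, Summable (fun k => |h k φ|))
    (hh_unif : ∀ R : ℝ, TendstoUniformlyOn (fun (N : ℕ) φ => ∑ k ∈ Finset.range N, |h k φ|)
      (fun φ => ∑' k, |h k φ|) atTop {φ | ‖φ‖ ≤ R})
    (hh_jump : ∀ φ (θ : Icc (-r) 0),
      jump (fun θ' => g_d θ' φ) θ = ∑' k, ({k | (θ : ℝ) = -η k φ} : Set ℕ).indicator (h · φ) k) :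
    -- for every initial function there is a global mild solution
    ∀ φ : Phase Ω r, ∃ u : ℝ → L2 Ω, ∀ T : ℝ, 0 < T → IsMildSolution A d b f g hg φ T u := by
  have hr0 : -r ≤ 0 := by linarith
  have hfin : IsFiniteMeasure (volume.restrict Ω) := ⟨by
    rw [Measure.restrict_apply_univ]
    exact hΩ_bdd.measure_lt_top⟩
  have hb : LipschitzWith L_b.toNNReal b := LipschitzWith.of_dist_le_mul fun s t => by
    rw [Real.dist_eq, Real.dist_eq]
    exact (hb_lip s t).trans
      (mul_le_mul_of_nonneg_right (Real.le_coe_toNNReal _) (abs_nonneg _))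
  have hloc : TendstoLocallyUniformly (fun (N : ℕ) φ => ∑ k ∈ Finset.range N, |h k φ|)
      (fun φ => ∑' k, |h k φ|) atTop := fun u hu φ =>
    ⟨{ψ | ‖ψ‖ ≤ ‖φ‖ + 1}, 
      (continuous_norm.continuousAt.eventually_lt continuousAt_const
        (lt_add_one ‖φ‖)).mono fun _ h => le_of_lt h,
      hh_unif (‖φ‖ + 1) u hu⟩
  have hcont := continuous_integral_vectorMeasure hr0 hg (V := M_Vg.toNNReal) hg_unif
    (v := g_d) (c := fun θ φ => g_ac θ φ + g_s θ φ)
    (fun θ φ => (hg_split θ φ).trans (add_assoc _ _ _)) hg_d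
    (fun φ => ((hg_ac φ).continuous hr0).add (hg_s φ).1)
    (fun θ => (hg_ac_cont θ).add (hg_s_cont θ))
    (τ := fun k φ => ⟨-η k φ, neg_le_neg (hη_mem k φ).2, neg_nonpos.2 (hη_mem k φ).1⟩)
    (fun k => (hη_cont k).neg.subtype_mk _) hh_cont hh_summable hloc (fun φ θ => by
      rw [hh_jump φ θ]
      simp only [Subtype.ext_iff])
  obtain ⟨K, B₁, B₂, hB₁, hB₂, hresp⟩ :=
    exists_response_bounds hΩ_open hf_meas hf_bdd hb hC₁ hC₂ hb_growth
  obtain ⟨hmem, hFc, a₁, a₂, ha₁, ha₂, hFb⟩ := delayMap_spec (b := b) (f := f) (hg := hg)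
    hΩ_open.measurableSet hr0 hg_unif hcont hB₁ hB₂ (fun x hx => (hresp x hx).1)
    (fun x hx => (hresp x hx).2) (aestronglyMeasurable_response hΩ_open hf_meas hb.continuous)
  obtain ⟨hsg, hsn, hsc⟩ := expNeg_spec hA_dense hA_selfAdjoint hA_pos hA_res
  have hS : IsCompactContractionSemigroup (expNeg A) :=
    ⟨hsg.zero, hsg.add, hsg.strongly_continuous, hsn, hsc⟩
  -- The damping term becomes part of the functional through evaluation of the history at θ = 0.
  let G : C(Phase Ω r, L2 Ω) :=
    ⟨fun ψ => delayMap b f g hg ψ - d • ψ ⟨0, hr0, le_rfl⟩, by fun_prop⟩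
  have hG : ∀ ψ, ‖G ψ‖ ≤ a₁ + (a₂ + d) * ‖ψ‖ := fun ψ => by
    have h1 : ‖d • ψ ⟨0, hr0, le_rfl⟩‖ ≤ d * ‖ψ‖ := by
      rw [norm_smul, Real.norm_of_nonneg hd]
      exact mul_le_mul_of_nonneg_left (ψ.norm_coe_le_norm _) hd
    have h2 := norm_sub_le (delayMap b f g hg ψ) (d • ψ ⟨0, hr0, le_rfl⟩)
    have h3 := hFb ψ
    change ‖delayMap b f g hg ψ - d • ψ ⟨0, hr0, le_rfl⟩‖ ≤ _
    linarith
  intro φ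
  obtain ⟨u, hu⟩ := hS.exists_global_solution hr0 G ha₁ (by positivity) hG φ
  have hhist : ∀ t, history r u t = historySegment r u t := fun t => by
    rw [history, ContinuousMap.mkD_of_continuous (by fun_prop)]
    rfl
  have hforce : ∀ s, forcing G 0 u s = delayMap b f g hg (history r u s) - d • u s := fun s => by
    rw [hhist]
    simp [forcing, G, historySegment]
  have hu0 : u 0 = φ ⟨0, hr0, le_rfl⟩ := by
    rw [hu, duhamel_of_nonpos _ _ le_rfl, hS.freeEvolution_of_nonneg hr0 φ le_rfl, hS.zero]
    simp
  have hint : ∀ t s, s ≤ t → expNeg A (max (t - s) 0) (forcing G 0 u s) =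
      expNeg A (t - s) (delayMap b f g hg (history r u s) - d • u s) := fun t s hst => by
    rw [hforce, max_eq_left (sub_nonneg.2 hst)]
  refine ⟨u, fun T _ => ⟨u.continuous.continuousOn, fun θ => ?_, fun s _ => hmem _,
    fun t ht => ?_, fun t ht => ?_⟩⟩
  · rw [hu, duhamel_of_nonpos _ _ θ.2.2, hS.freeEvolution_of_nonpos hr0 φ θ.2.2, add_zero,
      IccExtend_val]
  · refine ((hS.continuous_integrand (forcing G 0 u) t).intervalIntegrable 0 t).congr ?_
    intro s hs
    rw [uIoc_of_le ht.1] at hs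
    exact hint t s hs.2
  · rw [hu t, hS.freeEvolution_of_nonneg hr0 φ ht.1, hu0, duhamel, max_eq_left ht.1]
    congr 1
    refine intervalIntegral.integral_congr fun s hs => ?_
    rw [uIcc_of_le ht.1] at hs
    exact hint t s hs.2
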